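/- Let $M$ be a smooth finite-dimensional real manifold (without boundary), $\Lambda$ a bivector field, $E$ a vector field and $\omega$ a $2$-form on $M$, all smooth. **Conventions.** $\Lambda^\#$ is given by $\langle\beta,\Lambda^\#(\alpha)\rangle=\Lambda(\alpha,\beta)$. A pair $(P,Q)$ of a $k$-vector field (or $k$-form) and a $(k-1)$-vector field (or $(k-1)$-form) is regarded as a section of $\bigwedge^k(TM\times\mathbb R)$ (or $\bigwedge^k(T^*M\times\mathbb R)$) by $(P,Q)((\alpha_1,f_1),\dots,(\alpha_k,f_k))=P(\alpha_1,\dots,\alpha_k)+\sum_i(-1)^{i+1}f_i\,Q(\alpha_1,\dots,\widehat{\alpha_i},\dots,\alpha_k)$. Put $(\Lambda,E)^\#(\alpha,f)=(\Lambda^\#(\alpha)+fE,\,-\langle\alpha,E\rangle)$ and, for a section $\eta$ of $\bigwedge^k(T^*M\times\mathbb R)$, $(\Lambda,E)^\#(\eta)(a_1,\dots,a_k)=(-1)^k\eta((\Lambda,E)^\#a_1,\dots,(\Lambda,E)^\#a_k)$. Let $[\cdot,\cdot]$ be the Schouten bracket of the Lie algebroid $TM\times\mathbb R$, whose anchor is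 the projection to $TM$ and whose bracket of sections is $[(X,f),(Y,g)]=([X,Y],X(g)-Y(f))$, normalised by $[P,Q\wedge R]=[P,Q]\wedge R+(-1)^{(p-1)q}Q\wedge[P,R]$; for $P,Q$ of degrees $p,q$ and the $1$-cocycle $\phi=(0,1)$ put $[P,Q]^{(0,1)}=[P,Q]+(p-1)P\wedge i_\phi Q+(-1)^p(q-1)\,i_\phi P\wedge Q$. Assume that $((\Lambda,E),\omega)$ is a twisted Jacobi structure, that is, $$\tfrac12[(\Lambda,E),(\Lambda,E)]^{(0,1)}=(\Lambda,E)^\#(d\omega,\omega),$$ and that it is transitive: at every $x\in M$ the image of the anchor $(\alpha,f)\mapsto\Lambda^\#(\alpha)+fE$, $T_x^*M\times\mathbb R\to T_xM$, has dimension $\dim M$ (is all of $T_xM$). 1) If $\dim M$ is even, then $((\Lambda,E),\omega)$ comes from a twisted locally conformal symplectic structure: there are a smooth $1$-form $\vartheta$ and a smooth non-degenerate $2$-form $\Theta$ on $M$ with $$d\vartheta=0,\qquad d(\Theta-\omega)+\vartheta\wedge(\Theta-\omega)=0,$$ such that $i(E)\Theta=-\vartheta$ and $i(\Lambda^\#(\alpha))\Theta=-\alpha$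 for all covectors $\alpha$; moreover $E=\Lambda^\#(\vartheta)$. 2) If $\dim M=2n+1$ is odd, then $((\Lambda,E),\omega)$ comes from a twisted contact structure: there is a smooth $1$-form $\vartheta$ on $M$ such that, with $\Theta=d\vartheta+\omega$, the form $\vartheta\wedge\Theta^n$ vanishes nowhere, and $$i(E)\vartheta=1,\quad i(E)\Theta=0,\quad \Lambda^\#(\vartheta)=0,\quad i(\Lambda^\#(\alpha))\Theta=-(\alpha-\langle\alpha,E\rangle\vartheta)\ \text{ for all covectors }\alpha.$$ -/

import Mathlib

open scoped Manifold

noncomputable section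

namespace TwistedJacobi

/-! ### Exterior algebra

A `k`-form on a space `U` is an alternating map `U [⋀^Fin k]→L[ℝ] ℝ`, and a `k`-vector on `U` is an
alternating map on the dual of `U`. -/

section Algebra

theorem update_castAdd_left {U : Type*} {p q : ℕ} [DecidableEq (Fin (p + q))] (v : Fin (p + q) → U)
    (i : Fin p) (x : U) :
    (fun k => Function.update v (Fin.castAdd q i) x (Fin.castAdd q k)) =
      Function.update (fun k => v (Fin.castAdd q k)) i x :=
  Function.update_comp_eq_of_injective' v (Fin.castAdd_injective p q) i x

theorem update_natAdd_right {U : Type*} {p q : ℕ} [DecidableEq (Fin (p + q))] (v : Fin (p + q) → U)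
    (i : Fin q) (x : U) :
    (fun k => Function.update v (Fin.natAdd p i) x (Fin.natAdd p k)) =
      Function.update (fun k => v (Fin.natAdd p k)) i x :=
  Function.update_comp_eq_of_injective' v (Fin.natAdd_injective q p) i x

theorem update_castAdd_right {U : Type*} {p q : ℕ} [DecidableEq (Fin (p + q))] (v : Fin (p + q) → U)
    (i : Fin p) (x : U) :
    (fun k => Function.update v (Fin.castAdd q i) x (Fin.natAdd p k)) =
      fun k => v (Fin.natAdd p k) := by
  funext k
  refine Function.update_of_ne (fun h => ?_) _ _
  have := congrArg Fin.val h
  simp at this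
  omega

theorem update_natAdd_left {U : Type*} {p q : ℕ} [DecidableEq (Fin (p + q))] (v : Fin (p + q) → U)
    (i : Fin q) (x : U) :
    (fun k => Function.update v (Fin.natAdd p i) x (Fin.castAdd q k)) =
      fun k => v (Fin.castAdd q k) := by
  funext k
  refine Function.update_of_ne (fun h => ?_) _ _
  have := congrArg Fin.val h
  simp at this
  omega

variable {U U' : Type*} [AddCommGroup U] [Module ℝ U] [TopologicalSpace U]
  [AddCommGroup U'] [Module ℝ U'] [TopologicalSpace U']

/-- Change of the name of the degree. -/
def castDegree {m n : ℕ} (h : m = n) (a : U [⋀^Fin m]→L[ℝ] ℝ) : U [⋀^Fin n]→L[ℝ] ℝ := h ▸ a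

/-- The product `(v₁, …, v_{p+q}) ↦ a (v₁, …, v_p) * b (v_{p+1}, …, v_{p+q})`. -/
def tensor {p q : ℕ} (a : U [⋀^Fin p]→L[ℝ] ℝ) (b : U [⋀^Fin q]→L[ℝ] ℝ) :
    ContinuousMultilinearMap ℝ (fun _ : Fin (p + q) => U) ℝ where
  toFun v := a (fun i => v (Fin.castAdd q i)) * b (fun j => v (Fin.natAdd p j))
  map_update_add' v i x y := by
    classical
    induction i using Fin.addCases with
    | left i => simp [update_castAdd_left, update_castAdd_right, add_mul]
    | right i => simp [update_natAdd_left, update_natAdd_right, mul_add]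
  map_update_smul' v i c x := by
    classical
    induction i using Fin.addCases with
    | left i => simp [update_castAdd_left, update_castAdd_right, mul_assoc]
    | right i => simp [update_natAdd_left, update_natAdd_right, mul_left_comm]
  cont := by
    refine Continuous.mul (a.cont.comp ?_) (b.cont.comp ?_) <;> fun_prop

/-- The wedge product
`(a ∧ b)(v₁, …, v_{p+q}) = 1/(p! q!) ∑_σ sign σ • a(v_{σ 1}, …, v_{σ p}) b(v_{σ (p+1)}, …)`. -/
def wedge {p q : ℕ} (a : U [⋀^Fin p]→L[ℝ] ℝ) (b : U [⋀^Fin q]→L[ℝ] ℝ) :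
    U [⋀^Fin (p + q)]→L[ℝ] ℝ :=
  ((p.factorial : ℝ) * (q.factorial : ℝ))⁻¹ • ContinuousMultilinearMap.alternatization (tensor a b)

/-- The wedge power `a ∧ ⋯ ∧ a` (`n` factors) of a `2`-form. -/
def wedgePow (a : U [⋀^Fin 2]→L[ℝ] ℝ) : (n : ℕ) → U [⋀^Fin (2 * n)]→L[ℝ] ℝ
  | 0 => ContinuousAlternatingMap.constOfIsEmpty ℝ U (Fin 0) (1 : ℝ)
  | n + 1 => wedge (wedgePow a n) a

/-- A linear form as an alternating map in one variable. -/
def oneForm (α : U →L[ℝ] ℝ) : U [⋀^Fin 1]→L[ℝ] ℝ :=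
  ContinuousAlternatingMap.ofSubsingleton ℝ U ℝ (0 : Fin 1) α

/-- Contraction of the first slot: `(ι_u a)(v₁, …, v_k) = a(u, v₁, …, v_k)`. -/
def contract {k : ℕ} (u : U) (a : U [⋀^Fin (k + 1)]→L[ℝ] ℝ) : U [⋀^Fin k]→L[ℝ] ℝ where
  toFun v := a (Matrix.vecCons u v)
  map_update_add' := @fun inst v i x y => by
    obtain rfl := Subsingleton.elim inst (instDecidableEqFin k)
    simp only [Matrix.vecCons, Fin.cons_update]
    exact a.map_update_add _ _ _ _
  map_update_smul' := @fun inst v i c x => by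
    obtain rfl := Subsingleton.elim inst (instDecidableEqFin k)
    simp only [Matrix.vecCons, Fin.cons_update]
    exact a.map_update_smul _ _ _ _
  map_eq_zero_of_eq' v i j h hij :=
    a.map_eq_zero_of_eq (Matrix.vecCons u v) (i := i.succ) (j := j.succ) (by simpa using h)
      (fun e => hij (Fin.succ_injective k e))
  cont := by
    refine a.cont.comp (continuous_pi fun i => ?_)
    refine Fin.cases ?_ (fun j => ?_) i
    · exact continuous_const
    · exact continuous_apply j

/-- The pair `(a, b)` of an alternating map of degree `k + 1` and one of degree `k` on `U`, as an
alternating map of degree `k + 1` on `U × ℝ`: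
`(a, b)((u₀, f₀), …, (u_k, f_k)) = a(u₀, …, u_k) + ∑ᵢ (-1)ⁱ fᵢ b(u₀, …, ûᵢ, …, u_k)`. -/
def pair {k : ℕ} (a : U [⋀^Fin (k + 1)]→L[ℝ] ℝ) (b : U [⋀^Fin k]→L[ℝ] ℝ) :
    (U × ℝ) [⋀^Fin (k + 1)]→L[ℝ] ℝ :=
  a.compContinuousLinearMap (ContinuousLinearMap.fst ℝ U ℝ) +
    castDegree (Nat.add_comm 1 k) (wedge (oneForm (ContinuousLinearMap.snd ℝ U ℝ))
      (b.compContinuousLinearMap (ContinuousLinearMap.fst ℝ U ℝ)))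

/-- The map `(α, f) ↦ (α ∘ T, f)` from `U'* × ℝ` to `U* × ℝ` induced by `T : U → U'`. -/
def dualProd (T : U →L[ℝ] U') : ((U' →L[ℝ] ℝ) × ℝ) →L[ℝ] ((U →L[ℝ] ℝ) × ℝ) :=
  (ContinuousLinearMap.precomp ℝ T).prodMap (ContinuousLinearMap.id ℝ ℝ)

/-- Evaluation of covectors at `u`, that is `u` as a `1`-vector. -/
def evalAt [ContinuousSMul ℝ U] (u : U) : (U →L[ℝ] ℝ) →L[ℝ] ℝ where
  toFun α := α u
  map_add' _ _ := rfl
  map_smul' _ _ := rfl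
  cont := continuous_eval_const u

theorem two_add_left (B : U [⋀^Fin 2]→L[ℝ] ℝ) (a b c : U) :
    B ![a + b, c] = B ![a, c] + B ![b, c] := by
  have e : ∀ z, Function.update ![0, c] 0 z = ![z, c] := fun z => by
    ext i; fin_cases i <;> rfl
  simpa only [e] using B.map_update_add ![0, c] 0 a b

theorem two_smul_left (B : U [⋀^Fin 2]→L[ℝ] ℝ) (r : ℝ) (a c : U) :
    B ![r • a, c] = r * B ![a, c] := by
  have e : ∀ z, Function.update ![0, c] 0 z = ![z, c] := fun z => by
    ext i; fin_cases i <;> rfl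
  simpa only [e, smul_eq_mul] using B.map_update_smul ![0, c] 0 r a

theorem two_add_right (B : U [⋀^Fin 2]→L[ℝ] ℝ) (a b c : U) :
    B ![c, a + b] = B ![c, a] + B ![c, b] := by
  have e : ∀ z, Function.update ![c, 0] 1 z = ![c, z] := fun z => by
    ext i; fin_cases i <;> rfl
  simpa only [e] using B.map_update_add ![c, 0] 1 a b

theorem two_smul_right (B : U [⋀^Fin 2]→L[ℝ] ℝ) (r : ℝ) (a c : U) :
    B ![c, r • a] = r * B ![c, a] := by
  have e : ∀ z, Function.update ![c, 0] 1 z = ![c, z] := fun z => by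
    ext i; fin_cases i <;> rfl
  simpa only [e, smul_eq_mul] using B.map_update_smul ![c, 0] 1 r a

variable [IsTopologicalAddGroup U] [ContinuousSMul ℝ U] [T2Space U] [FiniteDimensional ℝ U]

/-- The functional `β ↦ Λ (α, β)` on the dual of `U`. -/
def pairingWith (Λ : (U →L[ℝ] ℝ) [⋀^Fin 2]→L[ℝ] ℝ) (α : U →L[ℝ] ℝ) :
    Module.Dual ℝ (Module.Dual ℝ U) where
  toFun β := Λ ![α, LinearMap.toContinuousLinearMap β]
  map_add' β γ := by rw [map_add, two_add_right]
  map_smul' c β := by rw [map_smul, two_smul_right]; rfl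

/-- The morphism `Λ^# : U* → U` of a bivector `Λ`, determined by `β (Λ^# α) = Λ (α, β)`. -/
def sharp (Λ : (U →L[ℝ] ℝ) [⋀^Fin 2]→L[ℝ] ℝ) : (U →L[ℝ] ℝ) →ₗ[ℝ] U where
  toFun α := (Module.evalEquiv ℝ U).symm (pairingWith Λ α)
  map_add' α β := by
    rw [← map_add]
    congr 1
    ext γ
    exact two_add_left Λ _ _ _
  map_smul' c α := by
    rw [RingHom.id_apply, ← map_smul]
    congr 1
    ext γ
    exact two_smul_left Λ _ _ _

theorem apply_sharp (Λ : (U →L[ℝ] ℝ) [⋀^Fin 2]→L[ℝ] ℝ) (α β : U →L[ℝ] ℝ) :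
    β (sharp Λ α) = Λ ![α, β] :=
  Module.apply_evalEquiv_symm_apply ℝ U (β : U →ₗ[ℝ] ℝ) (pairingWith Λ α)

/-- `(Λ, E)^# (α, f) = (Λ^# α + f E, - α(E))`. -/
def jacobiSharp (Λ : (U →L[ℝ] ℝ) [⋀^Fin 2]→L[ℝ] ℝ) (E : U) :
    ((U →L[ℝ] ℝ) × ℝ) →ₗ[ℝ] (U × ℝ) where
  toFun a := (sharp Λ a.1 + a.2 • E, - a.1 E)
  map_add' a b := by
    ext
    · simp only [Prod.fst_add, Prod.snd_add, map_add, add_smul]; abel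
    · simp; ring
  map_smul' c a := by
    ext <;> simp [mul_smul]

/-- The extension of `(Λ, E)^#` to alternating maps of degree `k`:
`(Λ, E)^#(η)(a₁, …, a_k) = (-1)^k η((Λ, E)^# a₁, …, (Λ, E)^# a_k)`. -/
def jacobiSharpExt {k : ℕ} (Λ : (U →L[ℝ] ℝ) [⋀^Fin 2]→L[ℝ] ℝ) (E : U)
    (η : (U × ℝ) [⋀^Fin k]→L[ℝ] ℝ) (a : Fin k → (U →L[ℝ] ℝ) × ℝ) : ℝ :=
  (-1 : ℝ) ^ k * η (fun i => jacobiSharp Λ E (a i))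

end Algebra

/-! ### Tensor fields on a manifold

`M` is a manifold without boundary modelled on the finite-dimensional space `V`. -/

section Manifold

variable {V : Type*} [NormedAddCommGroup V] [NormedSpace ℝ V]
  {M : Type*} [TopologicalSpace M] [ChartedSpace V M]

instance [FiniteDimensional ℝ V] (x : M) : FiniteDimensional ℝ (TangentSpace 𝓘(ℝ, V) x) :=
  inferInstanceAs (FiniteDimensional ℝ V)

instance (x : M) : T2Space (TangentSpace 𝓘(ℝ, V) x) :=
  inferInstanceAs (T2Space V)

variable (V M) in
/-- Differential forms of degree `k` (no smoothness imposed). -/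
abbrev Form (k : ℕ) := (x : M) → TangentSpace 𝓘(ℝ, V) x [⋀^Fin k]→L[ℝ] ℝ

variable (V M) in
/-- Fields of covectors (no smoothness imposed). -/
abbrev CovectorField := (x : M) → TangentSpace 𝓘(ℝ, V) x →L[ℝ] ℝ

variable (V M) in
/-- Vector fields (no smoothness imposed). -/
abbrev VField := (x : M) → TangentSpace 𝓘(ℝ, V) x

variable (V M) in
/-- Bivector fields (no smoothness imposed). -/
abbrev BivectorField :=
  (x : M) → (TangentSpace 𝓘(ℝ, V) x →L[ℝ] ℝ) [⋀^Fin 2]→L[ℝ] ℝ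

variable (V M) in
/-- Sections of `⋀ᵏ(TM × ℝ)` (no smoothness imposed), as alternating maps on `T*M × ℝ`. -/
abbrev MultiSection (k : ℕ) :=
  (x : M) → ((TangentSpace 𝓘(ℝ, V) x →L[ℝ] ℝ) × ℝ) [⋀^Fin k]→L[ℝ] ℝ

/-- The differential at `x` of the chart centred at `x₀`. -/
def chartDeriv (x₀ x : M) : TangentSpace 𝓘(ℝ, V) x →L[ℝ] V :=
  (NormedSpace.fromTangentSpace (extChartAt 𝓘(ℝ, V) x₀ x)).toContinuousLinearMap ∘L
    mfderiv 𝓘(ℝ, V) 𝓘(ℝ, V) (extChartAt 𝓘(ℝ, V) x₀) x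

/-- The differential at `y` of the inverse of the chart centred at `x₀`. -/
def chartSymmDeriv (x₀ : M) (y : V) :
    V →L[ℝ] TangentSpace 𝓘(ℝ, V) ((extChartAt 𝓘(ℝ, V) x₀).symm y) :=
  mfderiv 𝓘(ℝ, V) 𝓘(ℝ, V) (extChartAt 𝓘(ℝ, V) x₀).symm y ∘L
    (NormedSpace.fromTangentSpace y).symm.toContinuousLinearMap

/-- The coordinate expression of a form in the chart centred at `x₀`: its pullback under the
inverse of the chart. -/
def Form.inChart {k : ℕ} (η : Form V M k) (x₀ : M) (y : V) : V [⋀^Fin k]→L[ℝ] ℝ :=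
  (η ((extChartAt 𝓘(ℝ, V) x₀).symm y)).compContinuousLinearMap (chartSymmDeriv x₀ y)

/-- The coordinate expression of a section of `⋀ᵏ(TM × ℝ)` in the chart centred at `x₀`: its
pushforward under the chart. -/
def MultiSection.inChart {k : ℕ} (P : MultiSection V M k) (x₀ : M) (y : V) :
    ((V →L[ℝ] ℝ) × ℝ) [⋀^Fin k]→L[ℝ] ℝ :=
  (P ((extChartAt 𝓘(ℝ, V) x₀).symm y)).compContinuousLinearMap
    (dualProd (chartDeriv x₀ ((extChartAt 𝓘(ℝ, V) x₀).symm y)))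

/-- Smooth differential forms. -/
def Form.IsSmooth {k : ℕ} (η : Form V M k) : Prop :=
  ∀ x₀ : M, ContDiffOn ℝ (⊤ : ℕ∞) (η.inChart x₀) (extChartAt 𝓘(ℝ, V) x₀).target

/-- Smooth sections of `⋀ᵏ(TM × ℝ)`. -/
def MultiSection.IsSmooth {k : ℕ} (P : MultiSection V M k) : Prop :=
  ∀ x₀ : M, ContDiffOn ℝ (⊤ : ℕ∞) (P.inChart x₀) (extChartAt 𝓘(ℝ, V) x₀).target

/-- The exterior derivative of a form on `M`, computed at `x` in the chart centred at `x`. -/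
def Form.d {k : ℕ} (η : Form V M k) : Form V M (k + 1) := fun x =>
  (extDeriv (η.inChart x) (extChartAt 𝓘(ℝ, V) x x)).compContinuousLinearMap (chartDeriv x x)

/-- A field of covectors as a form of degree `1`. -/
def CovectorField.toForm (ϑ : CovectorField V M) : Form V M 1 := fun x => oneForm (ϑ x)

/-- The section `(Λ, E)` of `⋀²(TM × ℝ)`:
`(Λ, E)((α, f), (β, g)) = Λ(α, β) + f β(E) - g α(E)`. -/
def jacobiSection (Λ : BivectorField V M) (E : VField V M) : MultiSection V M 2 := fun x =>
  pair (Λ x) (oneForm (evalAt (E x)))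

variable [FiniteDimensional ℝ V]

/-- The Schouten bracket of the Lie algebroid `TM × ℝ`, with
`[(X, f), (Y, g)] = ([X, Y], X(g) - Y(f))`, in a chart. For coordinates `x^a` on `V`, the sections
`∂_a = (∂/∂x^a, 0)` and `(0, 1)` form a frame with vanishing brackets, the anchor of `(0, 1)` is
zero, and
`[P, Q] = ∑_a ((-1)^(deg P - 1) ι_{dx^a} P ∧ ∂_a Q - ∂_a P ∧ ι_{dx^a} Q)`.
It extends the Lie bracket of sections and satisfies
`[P, Q ∧ R] = [P, Q] ∧ R + (-1)^((deg P - 1) deg Q) Q ∧ [P, R]`. -/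
def schoutenFlat {p q : ℕ} (P : V → ((V →L[ℝ] ℝ) × ℝ) [⋀^Fin (p + 1)]→L[ℝ] ℝ)
    (Q : V → ((V →L[ℝ] ℝ) × ℝ) [⋀^Fin (q + 1)]→L[ℝ] ℝ) (y : V) :
    ((V →L[ℝ] ℝ) × ℝ) [⋀^Fin (p + q + 1)]→L[ℝ] ℝ :=
  ∑ a, ((-1 : ℝ) ^ p •
      wedge (contract (dx a) (P y)) (fderiv ℝ Q y (Module.finBasis ℝ V a)) -
    castDegree (Nat.add_right_comm p 1 q)
      (wedge (fderiv ℝ P y (Module.finBasis ℝ V a)) (contract (dx a) (Q y))))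
where
  /-- The section `(dx^a, 0)` of `T*V × ℝ`. -/
  dx (a : Fin (Module.finrank ℝ V)) : (V →L[ℝ] ℝ) × ℝ :=
    (LinearMap.toContinuousLinearMap ((Module.finBasis ℝ V).coord a), 0)

/-- The Schouten bracket modified by the `1`-cocycle `κ` of `TM × ℝ`, in a chart:
`[P, Q]^κ = [P, Q] + (deg P - 1) P ∧ ι_κ Q + (-1)^(deg P) (deg Q - 1) ι_κ P ∧ Q`. -/
def schoutenFlatMod {p q : ℕ} (κ : (V →L[ℝ] ℝ) × ℝ)
    (P : V → ((V →L[ℝ] ℝ) × ℝ) [⋀^Fin (p + 1)]→L[ℝ] ℝ)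
    (Q : V → ((V →L[ℝ] ℝ) × ℝ) [⋀^Fin (q + 1)]→L[ℝ] ℝ) (y : V) :
    ((V →L[ℝ] ℝ) × ℝ) [⋀^Fin (p + q + 1)]→L[ℝ] ℝ :=
  schoutenFlat P Q y +
    (p : ℝ) • castDegree (Nat.add_right_comm p 1 q) (wedge (P y) (contract κ (Q y))) +
    ((-1 : ℝ) ^ (p + 1) * (q : ℝ)) • wedge (contract κ (P y)) (Q y)

/-- The bracket `[P, Q]^{(0,1)}` of sections of `⋀(TM × ℝ)`, computed at `x` in the chart centred
at `x`. -/
def schouten01 {p q : ℕ} (P : MultiSection V M (p + 1)) (Q : MultiSection V M (q + 1)) :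
    MultiSection V M (p + q + 1) := fun x =>
  (schoutenFlatMod (0, 1) (P.inChart x) (Q.inChart x)
    (extChartAt 𝓘(ℝ, V) x x)).compContinuousLinearMap (dualProd (chartDeriv x x).inverse)

/-! ### Twisted Jacobi structures -/

/-- A twisted Jacobi structure `((Λ, E), ω)` on `M`: smooth fields with
`1/2 [(Λ, E), (Λ, E)]^{(0,1)} = (Λ, E)^#(dω, ω)`. -/
structure IsTwistedJacobi (Λ : BivectorField V M) (E : VField V M) (ω : Form V M 2) : Prop where
  smooth_jacobiSection : (jacobiSection Λ E).IsSmooth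
  smooth_form : ω.IsSmooth
  schouten_eq : ∀ (x : M) (a : Fin 3 → (TangentSpace 𝓘(ℝ, V) x →L[ℝ] ℝ) × ℝ),
    (1 / 2 : ℝ) * schouten01 (jacobiSection Λ E) (jacobiSection Λ E) x a =
      jacobiSharpExt (Λ x) (E x) (pair (ω.d x) (ω x)) a

/-- The anchor `(α, f) ↦ Λ^# α + f E` of the Lie algebroid `T*M × ℝ`. -/
def anchor (Λ : BivectorField V M) (E : VField V M) (x : M) :
    ((TangentSpace 𝓘(ℝ, V) x →L[ℝ] ℝ) × ℝ) →ₗ[ℝ] TangentSpace 𝓘(ℝ, V) x :=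
  LinearMap.fst ℝ _ ℝ ∘ₗ jacobiSharp (Λ x) (E x)

/-- The characteristic distribution, the image of the anchor; it consists of the tangent spaces of
the characteristic leaves. -/
def characteristicDistribution (Λ : BivectorField V M) (E : VField V M) (x : M) :
    Submodule ℝ (TangentSpace 𝓘(ℝ, V) x) :=
  LinearMap.range (anchor Λ E x)

/-- Transitivity: the characteristic leaf through every point has the dimension of `M`. -/
def IsTransitive (Λ : BivectorField V M) (E : VField V M) : Prop :=
  ∀ x : M, Module.finrank ℝ (characteristicDistribution Λ E x) = Module.finrank ℝ V

/-- A twisted locally conformal symplectic structure `(ϑ, Θ, ω)` on `M`. -/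
structure IsTwistedLCS (ϑ : CovectorField V M) (Θ ω : Form V M 2) : Prop where
  even_dim : Even (Module.finrank ℝ V)
  smooth_covector : ϑ.toForm.IsSmooth
  smooth_two_form : Θ.IsSmooth
  smooth_twist : ω.IsSmooth
  nondegenerate : ∀ (x : M) (u : TangentSpace 𝓘(ℝ, V) x), (∀ v, Θ x ![u, v] = 0) → u = 0
  closed : ∀ x : M, ϑ.toForm.d x = 0
  d_eq : ∀ x : M, Form.d (Θ - ω) x +
    castDegree (Nat.add_comm 1 2) (wedge (ϑ.toForm x) ((Θ - ω) x)) = 0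

/-- `(Λ, E)` is the pair defined by the twisted locally conformal symplectic structure
`(ϑ, Θ, ω)`: `i(E)Θ = -ϑ` and `i(Λ^# α)Θ = -α` for all `α`. -/
structure IsInducedByLCS (Λ : BivectorField V M) (E : VField V M) (ϑ : CovectorField V M)
    (Θ : Form V M 2) : Prop where
  contract_E : ∀ (x : M) (v : TangentSpace 𝓘(ℝ, V) x), Θ x ![E x, v] = - ϑ x v
  contract_sharp : ∀ (x : M) (α : TangentSpace 𝓘(ℝ, V) x →L[ℝ] ℝ) (v : TangentSpace 𝓘(ℝ, V) x),
    Θ x ![sharp (Λ x) α, v] = - α v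

/-- A twisted contact structure `(ϑ, ω)` on a manifold `M` of dimension `2n + 1`:
`ϑ ∧ (dϑ + ω)^n` vanishes nowhere. -/
structure IsTwistedContact (n : ℕ) (ϑ : CovectorField V M) (ω : Form V M 2) : Prop where
  dim_eq : Module.finrank ℝ V = 2 * n + 1
  smooth_covector : ϑ.toForm.IsSmooth
  smooth_twist : ω.IsSmooth
  wedge_ne_zero : ∀ x : M, wedge (ϑ.toForm x) (wedgePow (ϑ.toForm.d x + ω x) n) ≠ 0

/-- `(Λ, E)` is the pair defined by the twisted contact structure `(ϑ, ω)`: with `Θ = dϑ + ω`,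
`i(E)ϑ = 1`, `i(E)Θ = 0`, `Λ^# ϑ = 0` and `i(Λ^# α)Θ = -(α - α(E) ϑ)` for all `α`. -/
structure IsInducedByContact (Λ : BivectorField V M) (E : VField V M) (ϑ : CovectorField V M)
    (ω : Form V M 2) : Prop where
  apply_E : ∀ x : M, ϑ x (E x) = 1
  contract_E : ∀ (x : M) (v : TangentSpace 𝓘(ℝ, V) x), (ϑ.toForm.d x + ω x) ![E x, v] = 0
  sharp_eq_zero : ∀ x : M, sharp (Λ x) (ϑ x) = 0
  contract_sharp : ∀ (x : M) (α : TangentSpace 𝓘(ℝ, V) x →L[ℝ] ℝ) (v : TangentSpace 𝓘(ℝ, V) x),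
    (ϑ.toForm.d x + ω x) ![sharp (Λ x) α, v] = -(α v - α (E x) * ϑ x v)

end Manifold

end TwistedJacobi

end

/-!
Transitivity and the parity of `dim M` decide which of two skew maps is invertible. In even
dimension `(Λ, E)` is a `2`-vector on a space of odd dimension, hence degenerate; its kernel
contains some `(ϑ, -1)`, so `E = Λ^# ϑ`, `Λ^#` is invertible and `Θ` is `Λ` transported by `Λ^#`.
In odd dimension `Λ` itself is degenerate, `(Λ, E)^#` is invertible and `ϑ` is defined by
`(Λ, E)^# (ϑ, 0) = (0, -1)`.

In both cases `(Λ, E)^#` maps a section `(ϑ, s)` to a constant section `(0, r)`. Differentiating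
this relation trades the derivatives of `(Λ, E)` in the structure equation for those of `ϑ`: with
`r = 0` it says that `dϑ = 0`, with `r = -1` that the pullback of `Θ = dϑ + ω` by the anchor is
`Λ`. In even dimension the structure equation on `(α, 0)`, `(β, 0)`, `(γ, 0)` is then
`d(Θ - ω) + ϑ ∧ (Θ - ω) = 0`.
-/

noncomputable section

namespace TwistedJacobi

/-! ### Exterior products -/

section Tuples

variable {X : Type*} {p q : ℕ}

theorem succAbove_castAdd_castLE (i : Fin (p + 1)) (l : Fin p) :
    Fin.succAbove (n := p + 1 + q) (Fin.castAdd (q + 1) i) (Fin.castLE (by omega) l) =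
      Fin.castAdd (q + 1) (i.succAbove l) := by
  ext; simp [Fin.succAbove, Fin.lt_def, apply_ite Fin.val]

theorem succAbove_castAdd_natAdd (i : Fin (p + 1)) (l : Fin (q + 1)) :
    Fin.succAbove (n := p + 1 + q) (Fin.castAdd (q + 1) i) (Fin.cast (by omega) (Fin.natAdd p l)) =
      Fin.natAdd (p + 1) l := by
  ext; grind [Fin.succAbove]

theorem succAbove_natAdd_castAdd (i : Fin (q + 1)) (l : Fin (p + 1)) :
    Fin.succAbove (n := p + 1 + q) (Fin.natAdd (p + 1) i) (Fin.castAdd q l) =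
      Fin.castAdd (q + 1) l := by
  ext; grind [Fin.succAbove]

theorem succAbove_natAdd_natAdd (i : Fin (q + 1)) (l : Fin q) :
    Fin.succAbove (n := p + 1 + q) (Fin.natAdd (p + 1) i) (Fin.natAdd (p + 1) l) =
      Fin.natAdd (p + 1) (i.succAbove l) := by
  ext
  simp only [Fin.succAbove, Fin.lt_def, Fin.val_castSucc, Fin.val_natAdd]
  split_ifs <;> simp <;> omega

variable (u : X) (w : Fin (p + 1 + q) → X)

theorem insertNth_castAdd_comp_castAdd (i : Fin (p + 1)) :
    (fun l => Fin.insertNth (n := p + 1 + q) (α := fun _ => X) (Fin.castAdd (q + 1) i) u w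
      (Fin.castAdd (q + 1) l)) =
      Fin.insertNth (α := fun _ => X) i u (fun l => w (Fin.castLE (by omega) l)) := by
  refine Fin.eq_insertNth_iff.2 ⟨Fin.insertNth_apply_same .., funext fun l => ?_⟩
  rw [← Fin.insertNth_apply_succAbove (n := p + 1 + q) (α := fun _ => X)
    (Fin.castAdd (q + 1) i) u w,
    succAbove_castAdd_castLE, Fin.removeNth_apply]

theorem insertNth_castAdd_comp_natAdd (i : Fin (p + 1)) :
    (fun l => Fin.insertNth (n := p + 1 + q) (α := fun _ => X) (Fin.castAdd (q + 1) i) u w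
      (Fin.natAdd (p + 1) l)) =
      fun l : Fin (q + 1) => w (Fin.cast (by omega) (Fin.natAdd p l)) := by
  funext l
  rw [← succAbove_castAdd_natAdd i l]
  exact Fin.insertNth_apply_succAbove ..

theorem insertNth_natAdd_comp_castAdd (i : Fin (q + 1)) :
    (fun l => Fin.insertNth (n := p + 1 + q) (α := fun _ => X) (Fin.natAdd (p + 1) i) u w
      (Fin.castAdd (q + 1) l)) = fun l => w (Fin.castAdd q l) := by
  funext l
  rw [← succAbove_natAdd_castAdd i l]
  exact Fin.insertNth_apply_succAbove ..

theorem insertNth_natAdd_comp_natAdd (i : Fin (q + 1)) :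
    (fun l => Fin.insertNth (n := p + 1 + q) (α := fun _ => X) (Fin.natAdd (p + 1) i) u w
      (Fin.natAdd (p + 1) l)) =
      Fin.insertNth (α := fun _ => X) i u (fun l => w (Fin.natAdd (p + 1) l)) := by
  refine Fin.eq_insertNth_iff.2 ⟨Fin.insertNth_apply_same .., funext fun l => ?_⟩
  rw [← Fin.insertNth_apply_succAbove (n := p + 1 + q) (α := fun _ => X)
    (Fin.natAdd (p + 1) i) u w,
    succAbove_natAdd_natAdd, Fin.removeNth_apply]

end Tuples

section Permutations

variable {k : ℕ}

/-- The permutation sending `j` to `0` and the other indices, in increasing order, to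
`τ 0 + 1, τ 1 + 1, …`. -/
def insertZeroPerm (x : Fin (k + 1) × Equiv.Perm (Fin k)) : Equiv.Perm (Fin (k + 1)) :=
  Equiv.Perm.decomposeFin.symm (0, x.2) * x.1.cycleRange

theorem sign_insertZeroPerm (x : Fin (k + 1) × Equiv.Perm (Fin k)) :
    Equiv.Perm.sign (insertZeroPerm x) = (-1) ^ (x.1 : ℕ) * Equiv.Perm.sign x.2 := by
  simp [insertZeroPerm, mul_comm]

theorem vecCons_comp_insertZeroPerm {X : Type*} (u : X) (w : Fin k → X)
    (x : Fin (k + 1) × Equiv.Perm (Fin k)) :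
    Matrix.vecCons u w ∘ insertZeroPerm x = x.1.insertNth (α := fun _ => X) u (w ∘ x.2) := by
  rw [← Fin.cons_comp_cycleRange, insertZeroPerm, Equiv.Perm.coe_mul, ← Function.comp_assoc]
  congr 1
  funext i
  refine Fin.cases ?_ (fun l => ?_) i <;> simp [Matrix.vecCons]

theorem insertZeroPerm_bijective : Function.Bijective (insertZeroPerm (k := k)) := by
  rw [Fintype.bijective_iff_injective_and_card]
  refine ⟨?_, by simp [Fintype.card_perm, Nat.factorial_succ]⟩
  rintro ⟨i, σ⟩ ⟨j, τ⟩ h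
  obtain rfl : i = j := (insertZeroPerm (i, σ)).injective <| by
    conv_rhs => rw [h]
    simp [insertZeroPerm]
  simpa using Equiv.Perm.decomposeFin.symm.injective (mul_right_cancel h)

theorem sum_perm_vecCons {X : Type*} (m : (Fin (k + 1) → X) → ℝ) (u : X) (w : Fin k → X) :
    ∑ σ : Equiv.Perm (Fin (k + 1)), Equiv.Perm.sign σ • m (Matrix.vecCons u w ∘ σ) =
      ∑ j : Fin (k + 1), (-1) ^ (j : ℕ) *
        ∑ τ : Equiv.Perm (Fin k), Equiv.Perm.sign τ • m (j.insertNth u (w ∘ τ)) := by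
  rw [← (Equiv.ofBijective _ insertZeroPerm_bijective).sum_comp, Fintype.sum_prod_type]
  refine Finset.sum_congr rfl fun j _ => ?_
  rw [Finset.mul_sum]
  refine Finset.sum_congr rfl fun τ _ => ?_
  rw [Equiv.ofBijective_apply, sign_insertZeroPerm, vecCons_comp_insertZeroPerm]
  simp [Units.smul_def, mul_assoc]

theorem sum_perm_comp_cast {X : Type*} {m n : ℕ} (h : m = n) (F : (Fin m → X) → ℝ)
    (w : Fin n → X) :
    ∑ σ : Equiv.Perm (Fin n), Equiv.Perm.sign σ • F (fun i => (w ∘ σ) (Fin.cast h i)) =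
      ∑ σ : Equiv.Perm (Fin m), Equiv.Perm.sign σ • F ((fun i => w (Fin.cast h i)) ∘ σ) := by
  subst h; rfl

end Permutations

section Wedge

variable {U : Type*} [AddCommGroup U] [Module ℝ U] [TopologicalSpace U]

theorem castDegree_apply {m n : ℕ} (h : m = n) (a : U [⋀^Fin m]→L[ℝ] ℝ) (v : Fin n → U) :
    castDegree h a v = a (fun i => v (Fin.cast h i)) := by
  subst h; rfl

theorem contract_apply {k : ℕ} (u : U) (a : U [⋀^Fin (k + 1)]→L[ℝ] ℝ) (v : Fin k → U) :
    contract u a v = a (Matrix.vecCons u v) := rfl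

theorem oneForm_apply (α : U →L[ℝ] ℝ) (v : Fin 1 → U) : oneForm α v = α (v 0) := rfl

variable {p q : ℕ}

theorem tensor_apply (a : U [⋀^Fin p]→L[ℝ] ℝ) (b : U [⋀^Fin q]→L[ℝ] ℝ) (v : Fin (p + q) → U) :
    tensor a b v = a (fun i => v (Fin.castAdd q i)) * b (fun j => v (Fin.natAdd p j)) := rfl

theorem wedge_apply (a : U [⋀^Fin p]→L[ℝ] ℝ) (b : U [⋀^Fin q]→L[ℝ] ℝ) (v : Fin (p + q) → U) :
    wedge a b v = ((p.factorial : ℝ) * (q.factorial : ℝ))⁻¹ *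
      ∑ σ : Equiv.Perm (Fin (p + q)), Equiv.Perm.sign σ • tensor a b (v ∘ σ) := by
  simp only [wedge, ContinuousAlternatingMap.smul_apply,
    ContinuousMultilinearMap.alternatization_apply_apply, smul_eq_mul]

theorem map_insertNth {k : ℕ} (a : U [⋀^Fin (k + 1)]→L[ℝ] ℝ) (i : Fin (k + 1)) (u : U)
    (v : Fin k → U) : a (i.insertNth u v) = (-1) ^ (i : ℕ) * contract u a v := by
  have h : a (i.insertNth u v) = (-1) ^ (i : ℕ) • contract u a v :=
    a.toAlternatingMap.map_insertNth i u v
  rcases Nat.even_or_odd (i : ℕ) with hi | hi <;> simpa [hi.neg_one_pow] using h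

theorem tensor_insertNth_castAdd (a : U [⋀^Fin (p + 1)]→L[ℝ] ℝ) (b : U [⋀^Fin (q + 1)]→L[ℝ] ℝ)
    (u : U) (w : Fin (p + 1 + q) → U) (i : Fin (p + 1)) :
    tensor a b (Fin.insertNth (n := p + 1 + q) (Fin.castAdd (q + 1) i) u w) =
      (-1) ^ (i : ℕ) * tensor (contract u a) b (fun l => w (Fin.cast (by omega) l)) := by
  rw [tensor_apply, insertNth_castAdd_comp_castAdd, insertNth_castAdd_comp_natAdd, map_insertNth,
    mul_assoc]
  rfl

theorem tensor_insertNth_natAdd (a : U [⋀^Fin (p + 1)]→L[ℝ] ℝ) (b : U [⋀^Fin (q + 1)]→L[ℝ] ℝ)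
    (u : U) (w : Fin (p + 1 + q) → U) (i : Fin (q + 1)) :
    tensor a b (Fin.insertNth (n := p + 1 + q) (Fin.natAdd (p + 1) i) u w) =
      (-1) ^ (i : ℕ) * tensor a (contract u b) w := by
  rw [tensor_apply, insertNth_natAdd_comp_castAdd, insertNth_natAdd_comp_natAdd, map_insertNth,
    mul_left_comm]
  rfl

theorem sum_neg_one_pow_mul_sum {ι : Type*} [Fintype ι] (s f : ι → ℝ) (m k : ℕ) :
    ∑ j : Fin m, (-1) ^ (k + j : ℕ) * ∑ i, s i * ((-1) ^ (j : ℕ) * f i) =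
      (-1) ^ k * (m * ∑ i, s i * f i) := by
  have h (j : ℕ) : (-1 : ℝ) ^ (k + j) * (-1) ^ j = (-1) ^ k := by
    rw [pow_add, mul_assoc, ← mul_pow, neg_one_mul, neg_neg, one_pow, mul_one]
  simp_rw [mul_left_comm (s _), ← Finset.mul_sum, ← mul_assoc, h]
  rw [Finset.sum_const, Finset.card_univ, Fintype.card_fin, nsmul_eq_mul]
  ring

theorem sum_perm_tensor_vecCons (a : U [⋀^Fin (p + 1)]→L[ℝ] ℝ) (b : U [⋀^Fin (q + 1)]→L[ℝ] ℝ)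
    (u : U) (w : Fin (p + 1 + q) → U) :
    ∑ σ, Equiv.Perm.sign σ • tensor a b ((Matrix.vecCons u w : Fin (p + 1 + q + 1) → U) ∘ σ) =
      (p + 1) * ∑ σ, Equiv.Perm.sign σ •
          tensor (contract u a) b ((fun l => w (Fin.cast (by omega) l)) ∘ σ) +
        (-1) ^ (p + 1) * ((q + 1) * ∑ σ, Equiv.Perm.sign σ • tensor a (contract u b) (w ∘ σ)) := by
  refine (sum_perm_vecCons (k := p + 1 + q) (tensor a b) u w).trans ?_
  refine (Fin.sum_univ_add (a := p + 1) (b := q + 1) _).trans (congrArg₂ (· + ·) ?_ ?_)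
  · rw [← sum_perm_comp_cast (show p + (q + 1) = p + 1 + q by omega)]
    simpa [tensor_insertNth_castAdd, Units.smul_def, zsmul_eq_mul] using
      sum_neg_one_pow_mul_sum
        (fun σ : Equiv.Perm (Fin (p + 1 + q)) => ((Equiv.Perm.sign σ : ℤ) : ℝ))
        (fun σ => tensor (contract u a) b fun l => (w ∘ σ) (Fin.cast (by omega) l)) (p + 1) 0
  · simpa [tensor_insertNth_natAdd, Units.smul_def, zsmul_eq_mul] using
      sum_neg_one_pow_mul_sum
        (fun σ : Equiv.Perm (Fin (p + 1 + q)) => ((Equiv.Perm.sign σ : ℤ) : ℝ))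
        (fun σ => tensor a (contract u b) (w ∘ σ)) (q + 1) (p + 1)

theorem wedge_vecCons (a : U [⋀^Fin (p + 1)]→L[ℝ] ℝ) (b : U [⋀^Fin (q + 1)]→L[ℝ] ℝ)
    (u : U) (w : Fin (p + 1 + q) → U) :
    wedge a b (Matrix.vecCons u w : Fin (p + 1 + q + 1) → U) =
      wedge (contract u a) b (fun l => w (Fin.cast (by omega) l)) +
        (-1) ^ (p + 1) * wedge a (contract u b) w := by
  rw [wedge_apply, wedge_apply]
  refine Eq.trans (congrArg _ (sum_perm_tensor_vecCons a b u w)) ?_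
  rw [show wedge a (contract u b) w = _ from wedge_apply (p := p + 1) (q := q) ..]
  simp only [Nat.factorial_succ, Nat.cast_mul, Nat.cast_succ]
  field_simp

theorem sum_perm_sign_smul {k : ℕ} (a : U [⋀^Fin k]→L[ℝ] ℝ) (v : Fin k → U) :
    ∑ σ : Equiv.Perm (Fin k), Equiv.Perm.sign σ • a (v ∘ σ) = k.factorial * a v := by
  have h (σ : Equiv.Perm (Fin k)) : Equiv.Perm.sign σ • a (v ∘ σ) = a v := by
    rw [show a (v ∘ σ) = Equiv.Perm.sign σ • a v from a.toAlternatingMap.map_perm v σ, smul_smul,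
      Int.units_mul_self, one_smul]
  simp only [h, Finset.sum_const, Finset.card_univ, Fintype.card_perm, Fintype.card_fin,
    nsmul_eq_mul]

theorem wedge_degree_zero_right (a : U [⋀^Fin p]→L[ℝ] ℝ) (b : U [⋀^Fin 0]→L[ℝ] ℝ) :
    wedge a b = b ![] • a := by
  ext v
  have h (σ : Equiv.Perm (Fin (p + 0))) : Equiv.Perm.sign σ • tensor a b (v ∘ σ) =
      b ![] * Equiv.Perm.sign σ • a ((v : Fin p → U) ∘ σ) := by
    rw [tensor_apply, Subsingleton.elim (fun j => (v ∘ σ) (Fin.natAdd p j)) ![], mul_comm,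
      mul_smul_comm]
    rfl
  rw [wedge_apply, Finset.sum_congr rfl fun σ _ => h σ, ← Finset.mul_sum]
  refine (congrArg (fun s => _ * (_ * s)) (sum_perm_sign_smul a v)).trans ?_
  simp only [Nat.factorial_zero, Nat.cast_one, mul_one, ContinuousAlternatingMap.smul_apply,
    smul_eq_mul]
  field_simp

theorem wedge_degree_zero_left (a : U [⋀^Fin 0]→L[ℝ] ℝ) (b : U [⋀^Fin q]→L[ℝ] ℝ) :
    wedge a b = a ![] • castDegree (Nat.zero_add q).symm b := by
  ext v
  have h (σ : Equiv.Perm (Fin (0 + q))) : Equiv.Perm.sign σ • tensor a b (v ∘ σ) =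
      a ![] * Equiv.Perm.sign σ • castDegree (Nat.zero_add q).symm b (v ∘ σ) := by
    rw [tensor_apply, Subsingleton.elim (fun i => (v ∘ σ) (Fin.castAdd q i)) ![], mul_smul_comm,
      castDegree_apply]
    congr 4
    funext j
    exact congrArg (v ∘ σ) (Fin.ext (by simp))
  rw [wedge_apply, Finset.sum_congr rfl fun σ _ => h σ, ← Finset.mul_sum, sum_perm_sign_smul]
  simp only [Nat.factorial_zero, Nat.cast_one, one_mul, ContinuousAlternatingMap.smul_apply,
    smul_eq_mul, Nat.zero_add]
  field_simp

end Wedge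

section Contraction

variable {U : Type*} [AddCommGroup U] [Module ℝ U] [TopologicalSpace U]
  {W : Type*} [AddCommGroup W] [Module ℝ W] [TopologicalSpace W] {p q : ℕ}

theorem comp_one (a : U [⋀^Fin 1]→L[ℝ] ℝ) (T : W →L[ℝ] U) (x : W) :
    a.compContinuousLinearMap T ![x] = a ![T x] := by
  rw [ContinuousAlternatingMap.compContinuousLinearMap_apply, ← FinVec.map_eq]; rfl

theorem comp_two (a : U [⋀^Fin 2]→L[ℝ] ℝ) (T : W →L[ℝ] U) (x y : W) :
    a.compContinuousLinearMap T ![x, y] = a ![T x, T y] := by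
  rw [ContinuousAlternatingMap.compContinuousLinearMap_apply, ← FinVec.map_eq]; rfl

theorem comp_three (a : U [⋀^Fin 3]→L[ℝ] ℝ) (T : W →L[ℝ] U) (x y z : W) :
    a.compContinuousLinearMap T ![x, y, z] = a ![T x, T y, T z] := by
  rw [ContinuousAlternatingMap.compContinuousLinearMap_apply, ← FinVec.map_eq]; rfl

theorem ext_one {a b : U [⋀^Fin 1]→L[ℝ] ℝ} (h : ∀ x, a ![x] = b ![x]) : a = b := by
  ext v; rw [← FinVec.etaExpand_eq v]; exact h _

theorem ext_two {a b : U [⋀^Fin 2]→L[ℝ] ℝ} (h : ∀ x y, a ![x, y] = b ![x, y]) : a = b := by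
  ext v; rw [← FinVec.etaExpand_eq v]; exact h _ _

theorem ext_three {a b : U [⋀^Fin 3]→L[ℝ] ℝ} (h : ∀ x y z, a ![x, y, z] = b ![x, y, z]) :
    a = b := by
  ext v; rw [← FinVec.etaExpand_eq v]; exact h _ _ _

theorem contract_add (u : U) (a b : U [⋀^Fin (p + 1)]→L[ℝ] ℝ) :
    contract u (a + b) = contract u a + contract u b := rfl

theorem contract_smul (u : U) (c : ℝ) (a : U [⋀^Fin (p + 1)]→L[ℝ] ℝ) :
    contract u (c • a) = c • contract u a := rfl

theorem wedge_zero (a : U [⋀^Fin p]→L[ℝ] ℝ) : wedge a (0 : U [⋀^Fin q]→L[ℝ] ℝ) = 0 := by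
  ext v
  simp [wedge_apply, tensor_apply]

theorem zero_wedge (b : U [⋀^Fin q]→L[ℝ] ℝ) : wedge (0 : U [⋀^Fin p]→L[ℝ] ℝ) b = 0 := by
  ext v
  simp [wedge_apply, tensor_apply]

theorem smul_wedge (c : ℝ) (a : U [⋀^Fin p]→L[ℝ] ℝ) (b : U [⋀^Fin q]→L[ℝ] ℝ) :
    wedge (c • a) b = c • wedge a b := by
  ext v
  have h (w : Fin (p + q) → U) : tensor (c • a) b w = c * tensor a b w := mul_assoc ..
  simp only [ContinuousAlternatingMap.smul_apply, wedge_apply, h, ← mul_smul_comm, ← Finset.mul_sum,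
    smul_eq_mul, mul_left_comm]

theorem wedge_comp (a : U [⋀^Fin p]→L[ℝ] ℝ) (b : U [⋀^Fin q]→L[ℝ] ℝ) (T : W →L[ℝ] U) :
    (wedge a b).compContinuousLinearMap T =
      wedge (a.compContinuousLinearMap T) (b.compContinuousLinearMap T) := by
  ext v
  rw [ContinuousAlternatingMap.compContinuousLinearMap_apply, wedge_apply, wedge_apply]
  rfl

theorem wedgePow_comp (a : U [⋀^Fin 2]→L[ℝ] ℝ) (n : ℕ) (T : W →L[ℝ] U) :
    (wedgePow a n).compContinuousLinearMap T = wedgePow (a.compContinuousLinearMap T) n := by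
  induction n with
  | zero => rfl
  | succ n ih => exact (wedge_comp _ _ _).trans (by rw [ih]; rfl)

theorem contract_wedge (u : U) (a : U [⋀^Fin (p + 1)]→L[ℝ] ℝ) (b : U [⋀^Fin (q + 1)]→L[ℝ] ℝ) :
    contract (k := p + 1 + q) u (wedge (q := q + 1) a b) =
      castDegree (by omega) (wedge (contract u a) b) +
        (-1 : ℝ) ^ (p + 1) • wedge a (contract u b) := by
  ext w
  rw [ContinuousAlternatingMap.add_apply, castDegree_apply]
  exact wedge_vecCons a b u w

theorem contract_wedge_one (u : U) (a : U [⋀^Fin (p + 1)]→L[ℝ] ℝ) (b : U [⋀^Fin 1]→L[ℝ] ℝ) :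
    contract (k := p + 1) u (wedge a b) =
      wedge (contract u a) b + ((-1 : ℝ) ^ (p + 1) * b ![u]) • a := by
  rw [mul_smul]
  refine (contract_wedge (q := 0) u a b).trans ?_
  exact congrArg (_ + (-1 : ℝ) ^ (p + 1) • ·) (wedge_degree_zero_right a (contract u b))

theorem contract_wedge_two (u : U) (a : U [⋀^Fin (p + 1)]→L[ℝ] ℝ) (b : U [⋀^Fin 2]→L[ℝ] ℝ) :
    contract (k := p + 2) u (wedge (q := 2) a b) =
      wedge (contract u a) b + (-1 : ℝ) ^ (p + 1) • wedge a (contract u b) :=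
  contract_wedge (q := 1) u a b

theorem contract_contract_wedge_two (u v : U) (a : U [⋀^Fin (p + 1 + 1)]→L[ℝ] ℝ)
    (b : U [⋀^Fin 2]→L[ℝ] ℝ) :
    contract (k := p + 2) v (contract (k := p + 1 + 2) u (wedge (q := 2) a b)) =
      wedge (contract v (contract u a)) b +
        (-1 : ℝ) ^ p • (wedge (contract v a) (contract u b) - wedge (contract u a) (contract v b)) +
        b ![u, v] • a := by
  rw [contract_wedge_two, contract_add, contract_smul, contract_wedge_two, contract_wedge_one,
    contract_apply]
  ext w
  have h : (-1 : ℝ) ^ p * (-1) ^ p = 1 := by rw [← mul_pow]; norm_num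
  change _ + (-1 : ℝ) ^ (p + 1) * _ + (-1) ^ (p + 1 + 1) * (_ + (-1) ^ (p + 1 + 1) * _ * _) =
    _ + (-1 : ℝ) ^ p * (_ - _) + _ * _
  linear_combination b ![u, v] * a w * h

theorem contract_one_wedge (u : U) (a : U [⋀^Fin 1]→L[ℝ] ℝ) (b : U [⋀^Fin (q + 1)]→L[ℝ] ℝ) :
    contract (k := 1 + q) u (wedge (q := q + 1) a b) =
      a ![u] • castDegree (Nat.add_comm q 1) b - wedge a (contract u b) := by
  refine (contract_wedge (p := 0) u a b).trans ?_
  ext v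
  rw [wedge_degree_zero_left, ContinuousAlternatingMap.add_apply, castDegree_apply,
    ContinuousAlternatingMap.sub_apply, sub_eq_add_neg]
  refine congrArg₂ (· + ·) ?_ ?_
  · rw [ContinuousAlternatingMap.smul_apply, ContinuousAlternatingMap.smul_apply, castDegree_apply,
      castDegree_apply]
    rfl
  exact (congrArg (· * _) (by norm_num : (-1 : ℝ) ^ (0 + 1) = -1)).trans (neg_one_mul _)

theorem wedge_ne_zero_of_comp {a : U [⋀^Fin 1]→L[ℝ] ℝ} {b : U [⋀^Fin q]→L[ℝ] ℝ} {u : U}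
    {T : W →L[ℝ] U} (hu : a ![u] ≠ 0) (ha : a.compContinuousLinearMap T = 0)
    (hb : b.compContinuousLinearMap T ≠ 0) : wedge a b ≠ 0 := by
  intro h
  cases q with
  | zero =>
    rw [wedge_degree_zero_right] at h
    have hb' : b ![] = 0 :=
      (mul_eq_zero.1 (congrArg (· ![u]) h : b ![] * a ![u] = 0)).resolve_right hu
    exact hb (ContinuousAlternatingMap.ext fun v => Eq.trans (congrArg b (Matrix.empty_eq _)) hb')
  | succ q =>
    refine hb (ContinuousAlternatingMap.ext fun v => ?_)
    set w : Fin (1 + q) → U := fun i => T (v (i.cast (Nat.add_comm 1 q)))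
    have hw : wedge a (contract u b) w = 0 :=
      calc wedge a (contract u b) w = (wedge a (contract u b)).compContinuousLinearMap T
            fun i => v (i.cast (Nat.add_comm 1 q)) := rfl
        _ = 0 := by rw [wedge_comp, ha, zero_wedge]; rfl
    have hcontract := congrArg (· w) (contract_one_wedge u a b)
    simp only [h, ContinuousAlternatingMap.sub_apply, hw, ContinuousAlternatingMap.smul_apply,
      castDegree_apply, sub_zero] at hcontract
    exact (mul_eq_zero.1 hcontract.symm).resolve_left hu

theorem wedge_one_one (a b : U [⋀^Fin 1]→L[ℝ] ℝ) (x y : U) :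
    wedge a b ![x, y] = a ![x] * b ![y] - b ![x] * a ![y] :=
  calc wedge a b ![x, y] = contract (k := 1) x (wedge a b) ![y] := rfl
    _ = _ := by
      rw [contract_one_wedge (q := 0), wedge_degree_zero_right]; rfl

theorem wedge_one_two (a : U [⋀^Fin 1]→L[ℝ] ℝ) (b : U [⋀^Fin 2]→L[ℝ] ℝ) (x y z : U) :
    wedge a b ![x, y, z] = a ![x] * b ![y, z] - a ![y] * b ![x, z] + a ![z] * b ![x, y] :=
  calc wedge a b ![x, y, z] = contract (k := 2) x (wedge (p := 1) (q := 2) a b) ![y, z] := rfl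
    _ = a ![x] * b ![y, z] - wedge a (contract x b) ![y, z] := by
      rw [contract_one_wedge (q := 1)]; rfl
    _ = _ := by
      rw [wedge_one_one, contract_apply, contract_apply]; ring

theorem wedge_two_one (a : U [⋀^Fin 2]→L[ℝ] ℝ) (b : U [⋀^Fin 1]→L[ℝ] ℝ) (x y z : U) :
    wedge a b ![x, y, z] = b ![x] * a ![y, z] - b ![y] * a ![x, z] + b ![z] * a ![x, y] :=
  calc wedge a b ![x, y, z] = contract (k := 2) x (wedge (p := 2) (q := 1) a b) ![y, z] := rfl
    _ = wedge (contract x a) b ![y, z] + b ![x] * a ![y, z] := by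
      rw [contract_wedge_one]; simp
    _ = _ := by
      rw [wedge_one_one, contract_apply, contract_apply]; ring

theorem castDegree_wedge_two_one (a : U [⋀^Fin 2]→L[ℝ] ℝ) (b : U [⋀^Fin 1]→L[ℝ] ℝ)
    (h : 2 + 1 = 3) : castDegree h (wedge a b) = wedge b a :=
  ext_three fun x y z => (wedge_two_one a b x y z).trans (wedge_one_two b a x y z).symm

theorem pair_two_apply (a : U [⋀^Fin 2]→L[ℝ] ℝ) (b : U [⋀^Fin 1]→L[ℝ] ℝ) (x y : U × ℝ) :
    pair a b ![x, y] = a ![x.1, y.1] + x.2 * b ![y.1] - y.2 * b ![x.1] := by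
  rw [pair, ContinuousAlternatingMap.add_apply, comp_two]
  refine (congrArg (_ + ·) (wedge_one_one ..)).trans ?_
  simp only [comp_one, oneForm_apply, ContinuousLinearMap.coe_fst', ContinuousLinearMap.coe_snd',
    Matrix.cons_val_zero]
  ring

theorem pair_three_apply (a : U [⋀^Fin 3]→L[ℝ] ℝ) (b : U [⋀^Fin 2]→L[ℝ] ℝ) (x y z : U × ℝ) :
    pair a b ![x, y, z] =
      a ![x.1, y.1, z.1] + x.2 * b ![y.1, z.1] - y.2 * b ![x.1, z.1] + z.2 * b ![x.1, y.1] := by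
  rw [pair, ContinuousAlternatingMap.add_apply, comp_three]
  refine (congrArg (_ + ·) (wedge_one_two ..)).trans ?_
  simp only [comp_two, oneForm_apply, ContinuousLinearMap.coe_fst', ContinuousLinearMap.coe_snd',
    Matrix.cons_val_zero]
  ring

end Contraction

/-! ### Two-forms and their exterior powers -/

section TwoForm

theorem ker_ne_bot_of_isAlt_of_odd_finrank {K D : Type*} [Field K] [NeZero (2 : K)]
    [AddCommGroup D] [Module K D] [FiniteDimensional K D] {B : LinearMap.BilinForm K D}
    (hB : B.IsAlt) (hD : Odd (Module.finrank K D)) : B.ker ≠ ⊥ := by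
  rw [Ne, ← LinearMap.BilinForm.nondegenerate_iff_ker_eq_bot,
    LinearMap.BilinForm.nondegenerate_iff_det_ne_zero (Module.finBasis K D), not_not]
  set A := LinearMap.BilinForm.toMatrix (Module.finBasis K D) B
  have hA : A.transpose = -A := by
    ext i j
    simpa [A, LinearMap.BilinForm.toMatrix_apply] using (LinearMap.IsAlt.neg hB _ _).symm
  have hdet : A.det = -A.det := by
    conv_lhs => rw [← A.det_transpose, hA, Matrix.det_neg, Fintype.card_fin, hD.neg_one_pow,
      neg_one_mul]
  rw [eq_neg_iff_add_eq_zero, ← two_mul] at hdet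
  exact (mul_eq_zero.1 hdet).resolve_left two_ne_zero

variable {U : Type*} [AddCommGroup U] [Module ℝ U] [TopologicalSpace U]

/-- A `2`-form as a bilinear form. -/
def bilin (B : U [⋀^Fin 2]→L[ℝ] ℝ) : LinearMap.BilinForm ℝ U :=
  LinearMap.mk₂ ℝ (fun u v => B ![u, v]) (two_add_left B)
    (two_smul_left B) (fun c a b => two_add_right B a b c) (fun r a c => two_smul_right B r c a)

theorem bilin_apply (B : U [⋀^Fin 2]→L[ℝ] ℝ) (u v : U) : bilin B u v = B ![u, v] := rfl

theorem bilin_isAlt (B : U [⋀^Fin 2]→L[ℝ] ℝ) : (bilin B).IsAlt := fun u =>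
  B.map_eq_zero_of_eq ![u, u] (i := 0) (j := 1) rfl (by decide)

theorem two_self (B : U [⋀^Fin 2]→L[ℝ] ℝ) (u : U) : B ![u, u] = 0 := bilin_isAlt B u

theorem two_swap (B : U [⋀^Fin 2]→L[ℝ] ℝ) (u v : U) : B ![u, v] = -B ![v, u] :=
  (LinearMap.IsAlt.neg (bilin_isAlt B) v u).symm

theorem bilin_nondegenerate_iff {B : U [⋀^Fin 2]→L[ℝ] ℝ} :
    (bilin B).Nondegenerate ↔ ∀ u, (∀ v, B ![u, v] = 0) → u = 0 :=
  (bilin_isAlt B).isRefl.nondegenerate_iff_separatingLeft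

theorem contract_contract_wedgePow_comp {W : Type*} [AddCommGroup W] [Module ℝ W]
    [TopologicalSpace W] {Θ : U [⋀^Fin 2]→L[ℝ] ℝ} {e f : U} {T : W →L[ℝ] U}
    (he : (contract e Θ).compContinuousLinearMap T = 0)
    (hf : (contract f Θ).compContinuousLinearMap T = 0) (n : ℕ) :
    (contract f (contract (k := 2 * n + 1) e (wedgePow Θ (n + 1)))).compContinuousLinearMap T =
      ((n + 1) * Θ ![e, f]) • wedgePow (Θ.compContinuousLinearMap T) n := by
  induction n with
  | zero =>
    have h : wedgePow Θ 1 = Θ := (wedge_degree_zero_left _ _).trans (one_smul ℝ _)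
    rw [h, wedgePow]
    ext v
    simp [contract_apply, Matrix.empty_eq]
  | succ n ih =>
    set a : U [⋀^Fin (2 * n + 1 + 1)]→L[ℝ] ℝ := wedgePow Θ (n + 1) with ha
    calc _ = (wedge (contract f (contract e a)) Θ).compContinuousLinearMap T +
          (-1 : ℝ) ^ (2 * n) • ((wedge (contract f a) (contract e Θ)).compContinuousLinearMap T -
            (wedge (contract e a) (contract f Θ)).compContinuousLinearMap T) +
          Θ ![e, f] • a.compContinuousLinearMap T :=
        congrArg (·.compContinuousLinearMap T) (contract_contract_wedge_two e f a Θ)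
      _ = ((n + 1) * Θ ![e, f]) • wedgePow (Θ.compContinuousLinearMap T) (n + 1) +
          Θ ![e, f] • wedgePow (Θ.compContinuousLinearMap T) (n + 1) := by
        rw [wedge_comp, wedge_comp, wedge_comp, he, hf, wedge_zero, wedge_zero, sub_zero, smul_zero,
          add_zero, ih, smul_wedge, ha, wedgePow_comp]
        rfl
      _ = _ := by rw [← add_smul, ← add_one_mul]; norm_cast

theorem exists_apply_ne_zero_of_nondegenerate {K D : Type*} [Field K] [AddCommGroup D] [Module K D]
    [Nontrivial D] {B : LinearMap.BilinForm K D} (hB : B.Nondegenerate) : ∃ e f, B e f ≠ 0 := by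
  by_contra! h
  exact hB.ne_zero (LinearMap.ext₂ h)

theorem linearIndependent_of_apply_ne_zero {K D : Type*} [Field K] [AddCommGroup D] [Module K D]
    {B : LinearMap.BilinForm K D} (hB : B.IsAlt) {e f : D} (h : B e f ≠ 0) :
    LinearIndependent K ![e, f] := by
  refine LinearIndependent.pair_iff.2 fun s t hst => ⟨?_, ?_⟩
  · simpa [h, hB f] using congrArg (B · f) hst
  · simpa [h, hB e] using congrArg (B e) hst

theorem isCompl_span_pair_orthogonal {K D : Type*} [Field K] [AddCommGroup D] [Module K D]
    [FiniteDimensional K D] {B : LinearMap.BilinForm K D} (hB : B.IsAlt) {e f : D}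
    (h : B e f ≠ 0) :
    IsCompl (Submodule.span K {e, f}) (B.orthogonal (Submodule.span K {e, f})) := by
  rw [LinearMap.BilinForm.isCompl_orthogonal_iff_disjoint hB.isRefl, Submodule.disjoint_def]
  intro x hx hx'
  obtain ⟨s, t, rfl⟩ := Submodule.mem_span_pair.1 hx
  have he := hx' e (Submodule.subset_span (by simp))
  have hf := hx' f (Submodule.subset_span (by simp))
  have hfe : B f e ≠ 0 := fun h' => h (hB.isRefl _ _ h')
  simp only [map_add, map_smul, hB e, hB f, smul_eq_mul, mul_zero,
    zero_add, add_zero, mul_eq_zero, h, hfe, or_false] at he hf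
  simp [he, hf]

theorem wedgePow_ne_zero {n : ℕ} [FiniteDimensional ℝ U] {Θ : U [⋀^Fin 2]→L[ℝ] ℝ}
    (hΘ : (bilin Θ).Nondegenerate) (hU : Module.finrank ℝ U = 2 * n) : wedgePow Θ n ≠ 0 := by
  induction n generalizing U with
  | zero => exact fun h => one_ne_zero (congrArg (· ![]) h)
  | succ n ih =>
    have : Nontrivial U := Module.nontrivial_of_finrank_pos (R := ℝ) (by omega)
    obtain ⟨e, f, hef⟩ := exists_apply_ne_zero_of_nondegenerate hΘ
    have hrefl := (bilin_isAlt Θ).isRefl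
    set W := Submodule.span ℝ {e, f}
    set W' := (bilin Θ).orthogonal W
    have hWW' : IsCompl W W' := isCompl_span_pair_orthogonal (bilin_isAlt Θ) hef
    have hW' : (bilin (Θ.compContinuousLinearMap W'.subtypeL)).Nondegenerate := by
      have : (bilin Θ).restrict W' = bilin (Θ.compContinuousLinearMap W'.subtypeL) := by
        ext x y; exact (comp_two Θ W'.subtypeL x y).symm
      rw [← this, LinearMap.BilinForm.restrict_nondegenerate_iff_isCompl_orthogonal hrefl,
        LinearMap.BilinForm.orthogonal_orthogonal hΘ hrefl]
      exact hWW'.symm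
    have hdim : Module.finrank ℝ W' = 2 * n := by
      have hW : Module.finrank ℝ W = 2 := by
        have := finrank_span_eq_card (linearIndependent_of_apply_ne_zero (bilin_isAlt Θ) hef)
        rwa [Matrix.range_cons_cons_empty] at this
      rw [LinearMap.BilinForm.finrank_orthogonal hΘ, hU, hW]
      omega
    have hperp {u : U} (hu : u ∈ W) : (contract u Θ).compContinuousLinearMap W'.subtypeL = 0 :=
      ext_one fun x => (comp_one ..).trans (x.2 u hu)
    have hpow := contract_contract_wedgePow_comp (hperp (Submodule.subset_span (by simp)))
      (hperp (Submodule.subset_span (by simp))) n (e := e) (f := f)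
    intro h
    rw [h] at hpow
    exact smul_ne_zero (mul_ne_zero (by positivity) hef) (ih hW' hdim) hpow.symm

theorem finrank_ker_add_one {ϑ : U →L[ℝ] ℝ} [FiniteDimensional ℝ U] {E : U} (hE : ϑ E = 1) :
    Module.finrank ℝ (LinearMap.ker (ϑ : U →ₗ[ℝ] ℝ)) + 1 = Module.finrank ℝ U := by
  have hrange : LinearMap.range (ϑ : U →ₗ[ℝ] ℝ) = ⊤ :=
    LinearMap.range_eq_top.2 fun s => ⟨s • E, by simp [hE]⟩
  rw [← (ϑ : U →ₗ[ℝ] ℝ).finrank_range_add_finrank_ker, hrange, finrank_top, Module.finrank_self,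
    add_comm]

theorem wedge_oneForm_wedgePow_ne_zero {n : ℕ} [FiniteDimensional ℝ U] {ϑ : U →L[ℝ] ℝ}
    {Θ : U [⋀^Fin 2]→L[ℝ] ℝ} {E : U} (hdim : Module.finrank ℝ U = 2 * n + 1) (hE : ϑ E = 1)
    (hΘE : ∀ v, Θ ![E, v] = 0) (hΘ : ∀ u, ϑ u = 0 → (∀ v, Θ ![u, v] = 0) → u = 0) :
    wedge (oneForm ϑ) (wedgePow Θ n) ≠ 0 := by
  set K := LinearMap.ker (ϑ : U →ₗ[ℝ] ℝ)
  have hpow : (wedgePow Θ n).compContinuousLinearMap K.subtypeL ≠ 0 := by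
    rw [wedgePow_comp]
    refine wedgePow_ne_zero (bilin_nondegenerate_iff.2 fun u hu => Subtype.ext ?_)
      (by linarith [finrank_ker_add_one hE])
    refine hΘ u u.2 fun v => ?_
    have hv : v - ϑ v • E ∈ K := by simp [K, hE]
    have hEu : Θ ![(u : U), E] = 0 := by
      rw [two_swap, hΘE, neg_zero]
    calc Θ ![(u : U), v] = bilin Θ u (v - ϑ v • E) := by
          rw [map_sub, map_smul, bilin_apply, bilin_apply, hEu, smul_zero, sub_zero]
      _ = 0 := (comp_two ..).symm.trans (hu ⟨_, hv⟩)
  refine wedge_ne_zero_of_comp (u := E) (T := K.subtypeL) ?_ ?_ hpow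
  · rw [oneForm_apply, Matrix.cons_val_zero, hE]
    exact one_ne_zero
  · exact ext_one fun u => (comp_one ..).trans u.2

end TwoForm

/-! ### The pair of a bivector and a vector -/

section Pushforward

variable {U : Type*} [AddCommGroup U] [Module ℝ U] [TopologicalSpace U]
  {W : Type*} [AddCommGroup W] [Module ℝ W] [TopologicalSpace W]

theorem castDegree_comp {p q : ℕ} (h : p = q) (a : U [⋀^Fin p]→L[ℝ] ℝ) (T : W →L[ℝ] U) :
    (castDegree h a).compContinuousLinearMap T = castDegree h (a.compContinuousLinearMap T) := by
  subst h
  rfl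

theorem pair_comp {k : ℕ} (a : U [⋀^Fin (k + 1)]→L[ℝ] ℝ) (b : U [⋀^Fin k]→L[ℝ] ℝ)
    (T : W →L[ℝ] U) :
    pair (a.compContinuousLinearMap T) (b.compContinuousLinearMap T) =
      (pair a b).compContinuousLinearMap (T.prodMap (.id ℝ ℝ)) := by
  change _ = (a.compContinuousLinearMap (.fst ℝ U ℝ)).compContinuousLinearMap _ +
    (castDegree (Nat.add_comm 1 k) (wedge (oneForm (.snd ℝ U ℝ))
      (b.compContinuousLinearMap (.fst ℝ U ℝ)))).compContinuousLinearMap _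
  rw [castDegree_comp, wedge_comp]
  rfl

theorem dualProd_dualProd {T : W →L[ℝ] U} {S : U →L[ℝ] W} (h : T ∘L S = .id ℝ U)
    (a : (U →L[ℝ] ℝ) × ℝ) : dualProd S (dualProd T a) = a := by
  refine Prod.ext ?_ rfl
  change (a.1 ∘L T) ∘L S = a.1
  rw [ContinuousLinearMap.comp_assoc, h, ContinuousLinearMap.comp_id]

theorem isInvertible_dualProd {T : W →L[ℝ] U} (hT : T.IsInvertible) :
    (dualProd T).IsInvertible :=
  .of_inverse (g := dualProd T.inverse)
    (ContinuousLinearMap.ext (dualProd_dualProd hT.inverse_comp_self))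
    (ContinuousLinearMap.ext (dualProd_dualProd hT.self_comp_inverse))

theorem isInvertible_precomp {T : W →L[ℝ] U} (hT : T.IsInvertible) :
    (ContinuousLinearMap.precomp ℝ T : (U →L[ℝ] ℝ) →L[ℝ] W →L[ℝ] ℝ).IsInvertible :=
  .of_inverse (g := (.precomp ℝ T.inverse : (W →L[ℝ] ℝ) →L[ℝ] U →L[ℝ] ℝ))
    (ContinuousLinearMap.ext fun α => congrArg Prod.fst
      (dualProd_dualProd hT.inverse_comp_self (α, 0)))
    (ContinuousLinearMap.ext fun α => congrArg Prod.fst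
      (dualProd_dualProd hT.self_comp_inverse (α, 0)))

end Pushforward

section JacobiPair

variable {U : Type*} [AddCommGroup U] [Module ℝ U] [TopologicalSpace U]

/-- The pair `(Λ, E)` of a bivector and a vector, as a `2`-vector on `U × ℝ`; the value at a point
of `jacobiSection`. -/
def jacobiBivector [ContinuousSMul ℝ U] (Λ : (U →L[ℝ] ℝ) [⋀^Fin 2]→L[ℝ] ℝ) (E : U) :
    ((U →L[ℝ] ℝ) × ℝ) [⋀^Fin 2]→L[ℝ] ℝ :=
  pair Λ (oneForm (evalAt E))

variable [IsTopologicalAddGroup U] [ContinuousSMul ℝ U] [T2Space U] [FiniteDimensional ℝ U]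

theorem finrank_continuousDual : Module.finrank ℝ (U →L[ℝ] ℝ) = Module.finrank ℝ U :=
  (LinearMap.toContinuousLinearMap (𝕜 := ℝ) (E := U) (F' := ℝ)).finrank_eq.symm.trans
    Subspace.dual_finrank_eq

instance finiteDimensional_continuousDual : FiniteDimensional ℝ (U →L[ℝ] ℝ) :=
  Module.Finite.equiv (LinearMap.toContinuousLinearMap (𝕜 := ℝ) (E := U) (F' := ℝ))

theorem ext_continuousDual {u v : U} (h : ∀ β : U →L[ℝ] ℝ, β u = β v) : u = v :=
  (Module.evalEquiv ℝ U).injective <| LinearMap.ext fun φ => h (LinearMap.toContinuousLinearMap φ)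

variable (Λ : (U →L[ℝ] ℝ) [⋀^Fin 2]→L[ℝ] ℝ) (E : U)

theorem apply_sharp_swap (α β : U →L[ℝ] ℝ) : β (sharp Λ α) = -α (sharp Λ β) := by
  rw [apply_sharp, apply_sharp, two_swap]

theorem apply_sharp_self (α : U →L[ℝ] ℝ) : α (sharp Λ α) = 0 := by
  rw [apply_sharp, two_self]

theorem jacobiSharp_fst (a : (U →L[ℝ] ℝ) × ℝ) :
    (jacobiSharp Λ E a).1 = sharp Λ a.1 + a.2 • E := rfl

theorem jacobiSharp_snd (a : (U →L[ℝ] ℝ) × ℝ) : (jacobiSharp Λ E a).2 = -a.1 E := rfl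

theorem jacobiSharp_covector_fst (α : U →L[ℝ] ℝ) : (jacobiSharp Λ E (α, 0)).1 = sharp Λ α := by
  rw [jacobiSharp_fst, zero_smul, add_zero]

theorem jacobiBivector_apply (a b : (U →L[ℝ] ℝ) × ℝ) :
    jacobiBivector Λ E ![a, b] =
      b.1 (jacobiSharp Λ E a).1 + b.2 * (jacobiSharp Λ E a).2 := by
  rw [jacobiBivector, pair_two_apply, jacobiSharp_fst, jacobiSharp_snd, map_add, map_smul,
    apply_sharp, smul_eq_mul, oneForm_apply, oneForm_apply]
  change _ + a.2 * b.1 E - b.2 * a.1 E = _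
  ring

theorem jacobiBivector_covector_apply (α β : U →L[ℝ] ℝ) :
    jacobiBivector Λ E ![(α, 0), (β, 0)] = Λ ![α, β] := by
  rw [jacobiBivector_apply, jacobiSharp_covector_fst, apply_sharp, zero_mul, add_zero]

theorem exists_jacobiSharp_eq_zero_of_even (heven : Even (Module.finrank ℝ U)) :
    ∃ a ≠ 0, jacobiSharp Λ E a = 0 := by
  have hodd : Odd (Module.finrank ℝ ((U →L[ℝ] ℝ) × ℝ)) := by
    rw [Module.finrank_prod, finrank_continuousDual, Module.finrank_self]
    exact heven.add_one
  obtain ⟨a, ha, ha0⟩ := Submodule.exists_mem_ne_zero_of_ne_bot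
    (ker_ne_bot_of_isAlt_of_odd_finrank (bilin_isAlt (jacobiBivector Λ E)) hodd)
  have hker (b : (U →L[ℝ] ℝ) × ℝ) :
      b.1 (jacobiSharp Λ E a).1 + b.2 * (jacobiSharp Λ E a).2 = 0 := by
    rw [← jacobiBivector_apply]
    exact LinearMap.congr_fun ha b
  refine ⟨a, ha0, Prod.ext (ext_continuousDual fun β => ?_) ?_⟩
  · simpa only [zero_mul, add_zero, Prod.fst_zero, map_zero] using hker (β, 0)
  · simpa only [zero_apply, one_mul, zero_add, Prod.snd_zero] using hker (0, 1)

theorem exists_sharp_eq_zero_of_odd (hodd : Odd (Module.finrank ℝ U)) :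
    ∃ α ≠ 0, sharp Λ α = 0 := by
  rw [← finrank_continuousDual (U := U)] at hodd
  obtain ⟨α, hα, hα0⟩ := Submodule.exists_mem_ne_zero_of_ne_bot
    (ker_ne_bot_of_isAlt_of_odd_finrank (bilin_isAlt Λ) hodd)
  refine ⟨α, hα0, ext_continuousDual fun β => ?_⟩
  rw [apply_sharp, map_zero]
  exact LinearMap.congr_fun hα β

/-- `Λ^#` as a continuous linear map, so that `ContinuousLinearMap.inverse` applies to it. -/
def sharpL : (U →L[ℝ] ℝ) →L[ℝ] U := LinearMap.toContinuousLinearMap (sharp Λ)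

/-- `(Λ, E)^#` as a continuous linear map, so that `ContinuousLinearMap.inverse` applies to it. -/
def jacobiSharpL : ((U →L[ℝ] ℝ) × ℝ) →L[ℝ] U × ℝ :=
  LinearMap.toContinuousLinearMap (jacobiSharp Λ E)

/-- Surjectivity of the anchor `(α, f) ↦ Λ^# α + f E`. -/
def AnchorSurjective : Prop := ∀ u : U, ∃ a : (U →L[ℝ] ℝ) × ℝ, (jacobiSharp Λ E a).1 = u

theorem isInvertible_toContinuousLinearMap {D D' : Type*} [AddCommGroup D] [Module ℝ D]
    [TopologicalSpace D] [IsTopologicalAddGroup D] [ContinuousSMul ℝ D] [T2Space D]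
    [FiniteDimensional ℝ D] [AddCommGroup D'] [Module ℝ D'] [TopologicalSpace D']
    [IsTopologicalAddGroup D'] [ContinuousSMul ℝ D'] [T2Space D'] [FiniteDimensional ℝ D']
    {f : D →ₗ[ℝ] D'} (hf : f.ker = ⊥) (hD : Module.finrank ℝ D = Module.finrank ℝ D') :
    (LinearMap.toContinuousLinearMap f).IsInvertible :=
  ⟨(f.linearEquivOfInjective (LinearMap.ker_eq_bot.1 hf) hD).toContinuousLinearEquiv, rfl⟩

variable {Λ E}

theorem AnchorSurjective.eq_zero (h : AnchorSurjective Λ E) {α : U →L[ℝ] ℝ}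
    (hα : sharp Λ α = 0) (hαE : α E = 0) : α = 0 := by
  ext u
  obtain ⟨a, rfl⟩ := h u
  rw [jacobiSharp_fst, map_add, map_smul, hαE, apply_sharp_swap, hα, map_zero, neg_zero, smul_zero,
    add_zero, zero_apply]

theorem AnchorSurjective.isInvertible_sharpL (h : AnchorSurjective Λ E)
    (heven : Even (Module.finrank ℝ U)) : (sharpL Λ).IsInvertible := by
  obtain ⟨a, ha0, ha⟩ := exists_jacobiSharp_eq_zero_of_even Λ E heven
  have hsharp : sharp Λ a.1 + a.2 • E = 0 := congrArg Prod.fst ha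
  have haE : a.1 E = 0 := neg_eq_zero.1 (congrArg Prod.snd ha)
  have ha2 : a.2 ≠ 0 := fun ha2 => ha0 <| Prod.ext
    (h.eq_zero (by rw [← hsharp, ha2, zero_smul, add_zero]) haE) ha2
  refine isInvertible_toContinuousLinearMap (LinearMap.ker_eq_bot'.2 fun α hα => h.eq_zero hα ?_)
    finrank_continuousDual
  have hαE : α (sharp Λ a.1) + a.2 * α E = 0 := by
    rw [← smul_eq_mul, ← map_smul, ← map_add, hsharp, map_zero]
  rw [apply_sharp_swap, hα, map_zero, neg_zero, zero_add] at hαE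
  exact (mul_eq_zero.1 hαE).resolve_left ha2

theorem AnchorSurjective.isInvertible_jacobiSharpL (h : AnchorSurjective Λ E)
    (hodd : Odd (Module.finrank ℝ U)) : (jacobiSharpL Λ E).IsInvertible := by
  obtain ⟨ϑ, hϑ0, hϑ⟩ := exists_sharp_eq_zero_of_odd Λ hodd
  have hϑE : ϑ E ≠ 0 := fun hϑE => hϑ0 (h.eq_zero hϑ hϑE)
  refine isInvertible_toContinuousLinearMap (LinearMap.ker_eq_bot'.2 fun a ha => ?_)
    (by rw [Module.finrank_prod, Module.finrank_prod, finrank_continuousDual])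
  have hsharp : sharp Λ a.1 + a.2 • E = 0 := congrArg Prod.fst ha
  have haE : a.1 E = 0 := neg_eq_zero.1 (congrArg Prod.snd ha)
  have ha2 : a.2 = 0 := by
    have := congrArg ϑ hsharp
    rw [map_add, apply_sharp_swap, hϑ, map_zero, neg_zero, zero_add, map_smul, smul_eq_mul,
      map_zero] at this
    exact (mul_eq_zero.1 this).resolve_right hϑE
  rw [ha2, zero_smul, add_zero] at hsharp
  exact Prod.ext (h.eq_zero hsharp haE) ha2

end JacobiPair

section Naturality

variable {U : Type*} [AddCommGroup U] [Module ℝ U] [TopologicalSpace U] [ContinuousSMul ℝ U]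
  {W : Type*} [AddCommGroup W] [Module ℝ W] [TopologicalSpace W] [ContinuousSMul ℝ W]
  (Λ : (W →L[ℝ] ℝ) [⋀^Fin 2]→L[ℝ] ℝ) (E : W) (T : W →L[ℝ] U)

theorem jacobiBivector_map :
    jacobiBivector (Λ.compContinuousLinearMap (.precomp ℝ T)) (T E) =
      (jacobiBivector Λ E).compContinuousLinearMap (dualProd T) :=
  pair_comp Λ (oneForm (evalAt E)) (.precomp ℝ T)

variable [IsTopologicalAddGroup U] [T2Space U] [FiniteDimensional ℝ U]
  [IsTopologicalAddGroup W] [T2Space W] [FiniteDimensional ℝ W]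

theorem sharp_map (α : U →L[ℝ] ℝ) :
    sharp (Λ.compContinuousLinearMap (.precomp ℝ T)) α = T (sharp Λ (α ∘L T)) := by
  refine ext_continuousDual fun β => ?_
  rw [apply_sharp, comp_two]
  exact (apply_sharp Λ (α ∘L T) (β ∘L T)).symm

theorem jacobiSharp_map (a : (U →L[ℝ] ℝ) × ℝ) :
    jacobiSharp (Λ.compContinuousLinearMap (.precomp ℝ T)) (T E) a =
      T.prodMap (.id ℝ ℝ) (jacobiSharp Λ E (dualProd T a)) := by
  refine Prod.ext ?_ rfl
  rw [jacobiSharp_fst, sharp_map, ← map_smul, ← map_add]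
  rfl

theorem jacobiSharpExt_map {k : ℕ} (η : (U × ℝ) [⋀^Fin k]→L[ℝ] ℝ)
    (a : Fin k → (U →L[ℝ] ℝ) × ℝ) :
    jacobiSharpExt (Λ.compContinuousLinearMap (.precomp ℝ T)) (T E) η a =
      jacobiSharpExt Λ E (η.compContinuousLinearMap (T.prodMap (.id ℝ ℝ)))
        (fun i => dualProd T (a i)) := by
  simp only [jacobiSharpExt, jacobiSharp_map]
  rfl

variable {Λ E T}

theorem isInvertible_sharpL_map (hΛ : (sharpL Λ).IsInvertible) (hT : T.IsInvertible) :
    (sharpL (Λ.compContinuousLinearMap (.precomp ℝ T))).IsInvertible := by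
  have : sharpL (Λ.compContinuousLinearMap (.precomp ℝ T)) =
      T ∘L sharpL Λ ∘L .precomp ℝ T := ContinuousLinearMap.ext (sharp_map Λ T)
  rw [this]
  exact hT.comp (hΛ.comp (isInvertible_precomp hT))

theorem isInvertible_jacobiSharpL_map (hΛE : (jacobiSharpL Λ E).IsInvertible)
    (hT : T.IsInvertible) :
    (jacobiSharpL (Λ.compContinuousLinearMap (.precomp ℝ T)) (T E)).IsInvertible := by
  have : jacobiSharpL (Λ.compContinuousLinearMap (.precomp ℝ T)) (T E) =
      T.prodMap (.id ℝ ℝ) ∘L jacobiSharpL Λ E ∘L dualProd T :=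
    ContinuousLinearMap.ext (jacobiSharp_map Λ E T)
  obtain ⟨e, rfl⟩ := hT
  rw [this]
  exact .comp ⟨e.prodCongr (.refl ℝ ℝ), rfl⟩ (hΛE.comp (isInvertible_dualProd ⟨e, rfl⟩))

end Naturality

section LCSAndContactData

variable {U : Type*} [AddCommGroup U] [Module ℝ U] [TopologicalSpace U] [IsTopologicalAddGroup U]
  [ContinuousSMul ℝ U] [T2Space U] [FiniteDimensional ℝ U]

/-- The value at a point of the Lee form of the locally conformal symplectic structure of `(Λ, E)`:
the solution `ϑ` of `Λ^# ϑ = E` when `Λ^#` is invertible. -/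
def lcsCovector (Λ : (U →L[ℝ] ℝ) [⋀^Fin 2]→L[ℝ] ℝ) (E : U) : U →L[ℝ] ℝ := (sharpL Λ).inverse E

/-- The `2`-form corresponding to the bivector `Λ` under `Λ^#` when `Λ^#` is invertible. -/
def lcsForm (Λ : (U →L[ℝ] ℝ) [⋀^Fin 2]→L[ℝ] ℝ) : U [⋀^Fin 2]→L[ℝ] ℝ :=
  Λ.compContinuousLinearMap (sharpL Λ).inverse

/-- The value at a point of the contact form of `(Λ, E)`: the solution `ϑ` of `Λ^# ϑ = 0` and
`ϑ E = 1`, that is of `(Λ, E)^# (ϑ, 0) = (0, -1)`, when `(Λ, E)^#` is invertible. -/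
def contactCovector (Λ : (U →L[ℝ] ℝ) [⋀^Fin 2]→L[ℝ] ℝ) (E : U) : U →L[ℝ] ℝ :=
  ((jacobiSharpL Λ E).inverse (0, -1)).1

variable {Λ : (U →L[ℝ] ℝ) [⋀^Fin 2]→L[ℝ] ℝ} {E : U}

theorem lcsCovector_eq_iff (hΛ : (sharpL Λ).IsInvertible) {ϑ : U →L[ℝ] ℝ} :
    lcsCovector Λ E = ϑ ↔ E = sharp Λ ϑ :=
  hΛ.inverse_apply_eq

theorem sharp_lcsCovector (hΛ : (sharpL Λ).IsInvertible) : sharp Λ (lcsCovector Λ E) = E :=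
  hΛ.self_apply_inverse E

theorem jacobiSharp_lcsCovector (hΛ : (sharpL Λ).IsInvertible) :
    jacobiSharp Λ E (lcsCovector Λ E, -1) = 0 := by
  refine Prod.ext ?_ ?_
  · rw [jacobiSharp_fst, sharp_lcsCovector hΛ, neg_one_smul, add_neg_cancel, Prod.fst_zero]
  · have h := apply_sharp_self Λ (lcsCovector Λ E)
    rw [sharp_lcsCovector hΛ] at h
    rw [jacobiSharp_snd, h, neg_zero, Prod.snd_zero]

theorem lcsForm_apply_sharp_left (hΛ : (sharpL Λ).IsInvertible) (α : U →L[ℝ] ℝ) (v : U) :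
    lcsForm Λ ![sharp Λ α, v] = -α v := by
  have hα : (sharpL Λ).inverse (sharp Λ α) = α := hΛ.inverse_apply_self α
  rw [lcsForm, comp_two, hα, ← apply_sharp, apply_sharp_swap]
  exact congrArg (-α ·) (hΛ.self_apply_inverse v)

theorem lcsForm_apply_sharp_sharp (hΛ : (sharpL Λ).IsInvertible) (α β : U →L[ℝ] ℝ) :
    lcsForm Λ ![sharp Λ α, sharp Λ β] = Λ ![α, β] := by
  rw [lcsForm_apply_sharp_left hΛ, ← apply_sharp, apply_sharp_swap, neg_neg]

theorem lcsForm_apply (hΛ : (sharpL Λ).IsInvertible) (u v : U) :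
    lcsForm Λ ![u, v] = -lcsCovector Λ u v := by
  rw [← lcsForm_apply_sharp_left hΛ, sharp_lcsCovector hΛ]

theorem lcsForm_nondegenerate (hΛ : (sharpL Λ).IsInvertible) {u : U}
    (hu : ∀ v, lcsForm Λ ![u, v] = 0) : u = 0 :=
  ext_continuousDual fun β => by
    rw [map_zero, ← neg_eq_zero, ← lcsForm_apply_sharp_left hΛ, two_swap, hu, neg_zero]

theorem contactCovector_eq_iff (hΛE : (jacobiSharpL Λ E).IsInvertible) {ϑ : U →L[ℝ] ℝ} :
    contactCovector Λ E = ϑ ↔ jacobiSharp Λ E (ϑ, 0) = (0, -1) := by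
  refine ⟨fun h => ?_, fun h => congrArg Prod.fst (hΛE.inverse_apply_eq.2 h.symm)⟩
  subst h
  set a := (jacobiSharpL Λ E).inverse (0, -1)
  have ha : jacobiSharp Λ E a = (0, -1) := hΛE.self_apply_inverse _
  have hsharp : sharp Λ a.1 + a.2 • E = 0 := congrArg Prod.fst ha
  have haE : a.1 E = 1 := neg_injective (congrArg Prod.snd ha)
  have ha2 : a.2 = 0 := by
    have := congrArg a.1 hsharp
    rwa [map_add, apply_sharp_self, zero_add, map_smul, haE, smul_eq_mul, mul_one, map_zero] at this
  rwa [← ha2]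

theorem jacobiSharp_contactCovector (hΛE : (jacobiSharpL Λ E).IsInvertible) :
    jacobiSharp Λ E (contactCovector Λ E, 0) = (0, -1) :=
  (contactCovector_eq_iff hΛE).1 rfl

theorem sharp_contactCovector (hΛE : (jacobiSharpL Λ E).IsInvertible) :
    sharp Λ (contactCovector Λ E) = 0 := by
  rw [← jacobiSharp_covector_fst Λ E, jacobiSharp_contactCovector hΛE]

theorem contactCovector_apply (hΛE : (jacobiSharpL Λ E).IsInvertible) :
    contactCovector Λ E E = 1 :=
  neg_injective (congrArg Prod.snd (jacobiSharp_contactCovector hΛE))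

variable {W : Type*} [AddCommGroup W] [Module ℝ W] [TopologicalSpace W] [IsTopologicalAddGroup W]
  [ContinuousSMul ℝ W] [T2Space W] [FiniteDimensional ℝ W] {T : U →L[ℝ] W}

theorem lcsCovector_map (hΛ : (sharpL Λ).IsInvertible) (hT : T.IsInvertible) :
    lcsCovector (Λ.compContinuousLinearMap (.precomp ℝ T)) (T E) =
      lcsCovector Λ E ∘L T.inverse := by
  rw [lcsCovector_eq_iff (isInvertible_sharpL_map hΛ hT), sharp_map,
    ContinuousLinearMap.comp_assoc, hT.inverse_comp_self, ContinuousLinearMap.comp_id,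
    sharp_lcsCovector hΛ]

theorem lcsForm_map (hΛ : (sharpL Λ).IsInvertible) (hT : T.IsInvertible) :
    lcsForm (Λ.compContinuousLinearMap (.precomp ℝ T)) =
      (lcsForm Λ).compContinuousLinearMap T.inverse := by
  refine ext_two fun u v => ?_
  rw [lcsForm_apply (isInvertible_sharpL_map hΛ hT), comp_two, lcsForm_apply hΛ]
  conv_lhs => rw [← hT.self_apply_inverse u]
  rw [lcsCovector_map hΛ hT]
  rfl

theorem contactCovector_map (hΛE : (jacobiSharpL Λ E).IsInvertible) (hT : T.IsInvertible) :
    contactCovector (Λ.compContinuousLinearMap (.precomp ℝ T)) (T E) =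
      contactCovector Λ E ∘L T.inverse := by
  rw [contactCovector_eq_iff (isInvertible_jacobiSharpL_map hΛE hT), jacobiSharp_map]
  have hT' : dualProd T (contactCovector Λ E ∘L T.inverse, 0) = (contactCovector Λ E, 0) :=
    dualProd_dualProd hT.inverse_comp_self (contactCovector Λ E, 0)
  rw [hT', jacobiSharp_contactCovector hΛE]
  exact Prod.ext (map_zero T) rfl

end LCSAndContactData

/-! ### Smooth dependence -/

section Smoothness

variable {X : Type*} [NormedAddCommGroup X] [NormedSpace ℝ X]
  {D : Type*} [NormedAddCommGroup D] [NormedSpace ℝ D] [FiniteDimensional ℝ D]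
  {D' : Type*} [NormedAddCommGroup D'] [NormedSpace ℝ D']
  {s : Set X} {n : WithTop ℕ∞}

theorem contDiffOn_inverse {f : X → D →L[ℝ] D'} (hf : ContDiffOn ℝ n f s)
    (hinv : ∀ x ∈ s, (f x).IsInvertible) : ContDiffOn ℝ n (fun x => (f x).inverse) s :=
  have := FiniteDimensional.complete ℝ D
  fun x hx => (hinv x hx).contDiffAt_map_inverse.comp_contDiffWithinAt x (hf x hx)

theorem contDiffOn_alternating {k : ℕ} {f : X → D [⋀^Fin k]→L[ℝ] ℝ}
    (hf : ∀ v, ContDiffOn ℝ n (fun x => f x v) s) : ContDiffOn ℝ n f s := by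
  let b := Module.finBasis ℝ D
  let J : (D [⋀^Fin k]→L[ℝ] ℝ) →ₗ[ℝ] ((Fin k → Fin (Module.finrank ℝ D)) → ℝ) :=
    { toFun a r := a fun i => b (r i)
      map_add' _ _ := rfl
      map_smul' _ _ := rfl }
  have hJ : Function.Injective J := fun a a' h =>
    ContinuousAlternatingMap.toContinuousMultilinearMap_injective <|
      ContinuousMultilinearMap.toMultilinearMap_injective <|
        Module.Basis.ext_multilinear (fun _ => b) fun r => congrFun h r
  obtain ⟨K, hK⟩ := J.exists_leftInverse_of_injective (LinearMap.ker_eq_bot.2 hJ)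
  have hfK : f = fun x => LinearMap.toContinuousLinearMap K (J (f x)) :=
    funext fun x => (LinearMap.congr_fun hK (f x)).symm
  rw [hfK]
  exact (LinearMap.toContinuousLinearMap K).contDiff.comp_contDiffOn
    (contDiffOn_pi.2 fun r => hf _)

theorem contDiffOn_alternating_apply {k : ℕ} {f : X → D' [⋀^Fin k]→L[ℝ] ℝ}
    (hf : ContDiffOn ℝ n f s) (v : Fin k → D') : ContDiffOn ℝ n (fun x => f x v) s :=
  (ContinuousAlternatingMap.apply ℝ D' ℝ v).contDiff.comp_contDiffOn hf

theorem contDiffOn_oneForm {ϑ : X → D' →L[ℝ] ℝ} (hϑ : ContDiffOn ℝ n ϑ s) :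
    ContDiffOn ℝ n (fun x => oneForm (ϑ x)) s :=
  (ContinuousAlternatingMap.ofSubsingletonLIE (𝕜 := ℝ) (E := D') (F := ℝ)
    (0 : Fin 1)).contDiff.comp_contDiffOn hϑ

theorem contDiffOn_of_dual {f : X → D} (hf : ∀ β : D →L[ℝ] ℝ, ContDiffOn ℝ n (fun x => β (f x)) s) :
    ContDiffOn ℝ n f s := by
  rw [← (Module.finBasis ℝ D).equivFunL.comp_contDiffOn_iff]
  exact contDiffOn_pi.2 fun i =>
    hf (LinearMap.toContinuousLinearMap ((Module.finBasis ℝ D).coord i))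

variable {Λ : X → (D →L[ℝ] ℝ) [⋀^Fin 2]→L[ℝ] ℝ} {E : X → D}

theorem contDiffOn_jacobiSharp_fst
    (hP : ContDiffOn ℝ n (fun x => jacobiBivector (Λ x) (E x)) s)
    (a : (D →L[ℝ] ℝ) × ℝ) : ContDiffOn ℝ n (fun x => (jacobiSharp (Λ x) (E x) a).1) s :=
  contDiffOn_of_dual fun β => by
    simpa only [jacobiBivector_apply, zero_mul, add_zero] using
      contDiffOn_alternating_apply hP ![a, (β, 0)]

theorem contDiffOn_vector (hP : ContDiffOn ℝ n (fun x => jacobiBivector (Λ x) (E x)) s) :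
    ContDiffOn ℝ n E s := by
  simpa only [jacobiSharp_fst, map_zero, one_smul, zero_add] using
    contDiffOn_jacobiSharp_fst hP (0, 1)

theorem contDiffOn_sharpL (hP : ContDiffOn ℝ n (fun x => jacobiBivector (Λ x) (E x)) s) :
    ContDiffOn ℝ n (fun x => sharpL (Λ x)) s :=
  contDiffOn_clm_apply.2 fun α => (contDiffOn_jacobiSharp_fst hP (α, 0)).congr fun x _ =>
    (jacobiSharp_covector_fst (Λ x) (E x) α).symm

theorem contDiffOn_jacobiSharpL (hP : ContDiffOn ℝ n (fun x => jacobiBivector (Λ x) (E x)) s) :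
    ContDiffOn ℝ n (fun x => jacobiSharpL (Λ x) (E x)) s :=
  contDiffOn_clm_apply.2 fun a => (contDiffOn_jacobiSharp_fst hP a).prodMk
    (a.1.contDiff.comp_contDiffOn (contDiffOn_vector hP)).neg

theorem contDiffOn_lcsCovector (hP : ContDiffOn ℝ n (fun x => jacobiBivector (Λ x) (E x)) s)
    (hΛ : ∀ x ∈ s, (sharpL (Λ x)).IsInvertible) :
    ContDiffOn ℝ n (fun x => lcsCovector (Λ x) (E x)) s :=
  (contDiffOn_inverse (contDiffOn_sharpL hP) hΛ).clm_apply (contDiffOn_vector hP)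

theorem contDiffOn_lcsForm (hP : ContDiffOn ℝ n (fun x => jacobiBivector (Λ x) (E x)) s)
    (hΛ : ∀ x ∈ s, (sharpL (Λ x)).IsInvertible) : ContDiffOn ℝ n (fun x => lcsForm (Λ x)) s := by
  refine contDiffOn_alternating fun v => ?_
  have h : ContDiffOn ℝ n (fun x => -(sharpL (Λ x)).inverse (v 0) (v 1)) s :=
    (((contDiffOn_inverse (contDiffOn_sharpL hP) hΛ).clm_apply contDiffOn_const).clm_apply
      contDiffOn_const).neg
  refine h.congr fun x hx => ?_
  rw [← FinVec.etaExpand_eq v]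
  exact lcsForm_apply (hΛ x hx) (v 0) (v 1)

theorem contDiffOn_contactCovector
    (hP : ContDiffOn ℝ n (fun x => jacobiBivector (Λ x) (E x)) s)
    (hΛE : ∀ x ∈ s, (jacobiSharpL (Λ x) (E x)).IsInvertible) :
    ContDiffOn ℝ n (fun x => contactCovector (Λ x) (E x)) s :=
  ((contDiffOn_inverse (contDiffOn_jacobiSharpL hP) hΛE).clm_apply contDiffOn_const).fst

end Smoothness

/-! ### The structure equation in a chart -/

section FlatCalculus

variable {V : Type*} [NormedAddCommGroup V] [NormedSpace ℝ V]

theorem extDeriv_oneForm_apply (ϑ : V → V →L[ℝ] ℝ) (y u v : V) :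
    extDeriv (fun y => oneForm (ϑ y)) y ![u, v] = fderiv ℝ ϑ y u v - fderiv ℝ ϑ y v u := by
  have hD : fderiv ℝ (fun y => oneForm (ϑ y)) y = _ :=
    (ContinuousAlternatingMap.ofSubsingletonLIE (𝕜 := ℝ) (E := V) (F := ℝ) (0 : Fin 1)).comp_fderiv
      (f := ϑ) (x := y)
  rw [extDeriv, ContinuousAlternatingMap.alternatizeUncurryFin_apply, Fin.sum_univ_two, hD]
  simp only [Fin.val_zero, Fin.val_one, pow_zero, pow_one, one_smul, neg_smul, ← sub_eq_add_neg]
  rfl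

theorem extDeriv_two_apply (ω : V → V [⋀^Fin 2]→L[ℝ] ℝ) (y u v w : V) :
    extDeriv ω y ![u, v, w] =
      fderiv ℝ ω y u ![v, w] - fderiv ℝ ω y v ![u, w] + fderiv ℝ ω y w ![u, v] := by
  have h0 : Fin.removeNth 0 ![u, v, w] = ![v, w] := FinVec.etaExpand_eq _ |>.symm
  have h1 : Fin.removeNth 1 ![u, v, w] = ![u, w] := FinVec.etaExpand_eq _ |>.symm
  have h2 : Fin.removeNth 2 ![u, v, w] = ![u, v] := FinVec.etaExpand_eq _ |>.symm
  rw [extDeriv, ContinuousAlternatingMap.alternatizeUncurryFin_apply, Fin.sum_univ_three, h0, h1,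
    h2]
  simp [sub_eq_add_neg]

theorem fderiv_two_apply {D : Type*} [NormedAddCommGroup D] [NormedSpace ℝ D]
    {P : V → D [⋀^Fin 2]→L[ℝ] ℝ} {f g : V → D} {y : V} (hP : DifferentiableAt ℝ P y)
    (hf : DifferentiableAt ℝ f y) (hg : DifferentiableAt ℝ g y) (h : V) :
    fderiv ℝ (fun y => P y ![f y, g y]) y h =
      fderiv ℝ P y h ![f y, g y] + P y ![fderiv ℝ f y h, g y] + P y ![f y, fderiv ℝ g y h] := by
  have hfg (i : Fin 2) : DifferentiableAt ℝ ((![f, g] : Fin 2 → V → D) i) y := by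
    fin_cases i
    exacts [hf, hg]
  have e (z : V) : (fun i => (![f, g] : Fin 2 → V → D) i z) = ![f z, g z] :=
    (FinVec.etaExpand_eq _).symm
  have h := fderiv_continuousAlternatingMap_apply_apply hP hfg h
  simp only [e] at h
  rw [h, Fin.sum_univ_two, add_assoc]
  refine congrArg _ (congrArg₂ (· + ·) (congrArg _ ?_) (congrArg _ ?_)) <;>
  exact (FinVec.etaExpand_eq _).symm

variable [FiniteDimensional ℝ V]

theorem schoutenFlatMod_self (κ : (V →L[ℝ] ℝ) × ℝ)
    (P : V → ((V →L[ℝ] ℝ) × ℝ) [⋀^Fin 2]→L[ℝ] ℝ) (y : V) :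
    schoutenFlatMod (p := 1) (q := 1) κ P P y =
      (2 : ℝ) • (wedge (contract κ (P y)) (P y) -
        ∑ i, wedge (contract (schoutenFlat.dx i) (P y))
          (fderiv ℝ P y (Module.finBasis ℝ V i))) := by
  have hcast (a : ((V →L[ℝ] ℝ) × ℝ) [⋀^Fin 2]→L[ℝ] ℝ) (b : ((V →L[ℝ] ℝ) × ℝ) [⋀^Fin 1]→L[ℝ] ℝ) :
      castDegree (Nat.add_right_comm 1 1 1) (wedge a b) = wedge b a :=
    castDegree_wedge_two_one a b _
  have hsum {F : Type _} [AddCommGroup F] [Module ℝ F] (x : F)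
      (w : Fin (Module.finrank ℝ V) → F) :
      ∑ i, ((-1 : ℝ) ^ 1 • w i - w i) + ((1 : ℕ) : ℝ) • x +
        ((-1 : ℝ) ^ (1 + 1) * ((1 : ℕ) : ℝ)) • x = (2 : ℝ) • (x - ∑ i, w i) := by
    rw [Finset.sum_sub_distrib, ← Finset.smul_sum, Nat.cast_one]
    module
  rw [schoutenFlatMod, schoutenFlat, hcast]
  simp only [hcast]
  exact hsum (F := ((V →L[ℝ] ℝ) × ℝ) [⋀^Fin 3]→L[ℝ] ℝ) _ _

theorem fderiv_eq_sum_coord_smul {F : Type*} [NormedAddCommGroup F] [NormedSpace ℝ F]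
    (P : V → F) (y w : V) :
    fderiv ℝ P y w = ∑ i, (Module.finBasis ℝ V).coord i w •
      fderiv ℝ P y (Module.finBasis ℝ V i) := by
  conv_lhs => rw [← (Module.finBasis ℝ V).sum_repr w]
  simp only [map_sum, map_smul, Module.Basis.coord_apply]

section Structure

variable (Λ : V → (V →L[ℝ] ℝ) [⋀^Fin 2]→L[ℝ] ℝ) (E : V → V) (ω : V → V [⋀^Fin 2]→L[ℝ] ℝ) (y : V)

theorem contract_dx_jacobiBivector (i : Fin (Module.finrank ℝ V)) (a : (V →L[ℝ] ℝ) × ℝ) :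
    contract (schoutenFlat.dx i) (jacobiBivector (Λ y) (E y)) ![a] =
      -(Module.finBasis ℝ V).coord i (jacobiSharp (Λ y) (E y) a).1 := by
  refine (two_swap (jacobiBivector (Λ y) (E y)) _ _).trans (congrArg _ ?_)
  rw [jacobiBivector_apply, schoutenFlat.dx, zero_mul, add_zero]
  rfl

theorem contract_zero_one_jacobiBivector (a : (V →L[ℝ] ℝ) × ℝ) :
    contract (0, 1) (jacobiBivector (Λ y) (E y)) ![a] = -(jacobiSharp (Λ y) (E y) a).2 := by
  refine (two_swap (jacobiBivector (Λ y) (E y)) _ _).trans (congrArg _ ?_)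
  rw [jacobiBivector_apply, zero_apply, one_mul, zero_add]

theorem half_mul_schoutenFlatMod_jacobiBivector (a b c : (V →L[ℝ] ℝ) × ℝ) :
    let P := fun y => jacobiBivector (Λ y) (E y)
    let S := jacobiSharp (Λ y) (E y)
    (1 / 2 : ℝ) * schoutenFlatMod (p := 1) (q := 1) (0, 1) P P y (![a, b, c] : Fin 3 → _) =
      fderiv ℝ P y (S a).1 ![b, c] - fderiv ℝ P y (S b).1 ![a, c] + fderiv ℝ P y (S c).1 ![a, b] -
        ((S a).2 * P y ![b, c] - (S b).2 * P y ![a, c] + (S c).2 * P y ![a, b]) := by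
  intro P S
  have hmod : wedge (contract (0, 1) (P y)) (P y) ![a, b, c] =
      -((S a).2 * P y ![b, c] - (S b).2 * P y ![a, c] + (S c).2 * P y ![a, b]) := by
    refine (wedge_one_two ..).trans ?_
    simp only [P, S, contract_zero_one_jacobiBivector]
    ring
  have hterm (i : Fin (Module.finrank ℝ V)) :
      wedge (contract (schoutenFlat.dx i) (P y)) (fderiv ℝ P y (Module.finBasis ℝ V i))
        ![a, b, c] =
      -((Module.finBasis ℝ V).coord i (S a).1 *
          fderiv ℝ P y (Module.finBasis ℝ V i) ![b, c] -
        (Module.finBasis ℝ V).coord i (S b).1 * fderiv ℝ P y (Module.finBasis ℝ V i) ![a, c] +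
        (Module.finBasis ℝ V).coord i (S c).1 * fderiv ℝ P y (Module.finBasis ℝ V i) ![a, b]) := by
    refine (wedge_one_two ..).trans ?_
    simp only [P, S, contract_dx_jacobiBivector]
    ring
  have hD (w : V) (d : Fin 2 → (V →L[ℝ] ℝ) × ℝ) : fderiv ℝ P y w d =
      ∑ i, (Module.finBasis ℝ V).coord i w * fderiv ℝ P y (Module.finBasis ℝ V i) d := by
    rw [fderiv_eq_sum_coord_smul P y w, ContinuousAlternatingMap.sum_apply]
    rfl
  have hself : (1 / 2 : ℝ) * schoutenFlatMod (p := 1) (q := 1) (0, 1) P P y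
      (![a, b, c] : Fin 3 → _) = wedge (contract (0, 1) (P y)) (P y) ![a, b, c] -
        ∑ i, wedge (contract (schoutenFlat.dx i) (P y)) (fderiv ℝ P y (Module.finBasis ℝ V i))
          ![a, b, c] := by
    rw [schoutenFlatMod_self, ContinuousAlternatingMap.smul_apply, smul_eq_mul, ← mul_assoc,
      one_div_mul_cancel two_ne_zero, one_mul, ContinuousAlternatingMap.sub_apply,
      ContinuousAlternatingMap.sum_apply]
  rw [hself, hmod, Finset.sum_congr rfl fun i _ => hterm i, Finset.sum_neg_distrib, hD (S a).1,
    hD (S b).1, hD (S c).1, ← Finset.sum_sub_distrib, ← Finset.sum_add_distrib]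
  ring

/-- The equation `1/2 [(Λ, E), (Λ, E)]^{(0,1)} = (Λ, E)^#(dω, ω)` of a twisted Jacobi structure on
a vector space, at the point `y`. -/
def TwistedJacobiEqAt : Prop :=
  ∀ a : Fin 3 → (V →L[ℝ] ℝ) × ℝ, (1 / 2 : ℝ) *
    schoutenFlatMod (p := 1) (q := 1) (0, 1) (fun y => jacobiBivector (Λ y) (E y))
      (fun y => jacobiBivector (Λ y) (E y)) y a =
    jacobiSharpExt (Λ y) (E y) (pair (extDeriv ω y) (ω y)) a

variable {Λ E ω y}

theorem TwistedJacobiEqAt.expand (H : TwistedJacobiEqAt Λ E ω y) (a b c : (V →L[ℝ] ℝ) × ℝ) :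
    let P := fun y => jacobiBivector (Λ y) (E y)
    let S := jacobiSharp (Λ y) (E y)
    fderiv ℝ P y (S a).1 ![b, c] - fderiv ℝ P y (S b).1 ![a, c] + fderiv ℝ P y (S c).1 ![a, b] -
      ((S a).2 * P y ![b, c] - (S b).2 * P y ![a, c] + (S c).2 * P y ![a, b]) =
    -(extDeriv ω y ![(S a).1, (S b).1, (S c).1] + (S a).2 * ω y ![(S b).1, (S c).1] -
      (S b).2 * ω y ![(S a).1, (S c).1] + (S c).2 * ω y ![(S a).1, (S b).1]) := by
  intro P S
  have hS : (fun i => S (![a, b, c] i)) = ![S a, S b, S c] := (FinVec.etaExpand_eq _).symm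
  rw [← half_mul_schoutenFlatMod_jacobiBivector, H, jacobiSharpExt, hS, pair_three_apply]
  ring

theorem fderiv_jacobiBivector_of_eventually_jacobiSharp_eq
    (hP : DifferentiableAt ℝ (fun y => jacobiBivector (Λ y) (E y)) y)
    {ϑ : V → V →L[ℝ] ℝ} (hϑ : DifferentiableAt ℝ ϑ y) {s r : ℝ}
    (hS : ∀ᶠ z in nhds y, jacobiSharp (Λ z) (E z) (ϑ z, s) = (0, r)) (b : (V →L[ℝ] ℝ) × ℝ)
    (h : V) :
    fderiv ℝ (fun y => jacobiBivector (Λ y) (E y)) y h ![(ϑ y, s), b] =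
      fderiv ℝ ϑ y h (jacobiSharp (Λ y) (E y) b).1 := by
  have hconst : fderiv ℝ (fun z => jacobiBivector (Λ z) (E z) ![(ϑ z, s), b]) y = 0 := by
    have hr : (fun z => jacobiBivector (Λ z) (E z) ![(ϑ z, s), b]) =ᶠ[nhds y] fun _ => b.2 * r :=
      hS.mono fun z hz => by
        beta_reduce
        rw [jacobiBivector_apply, hz, map_zero, zero_add]
    rw [hr.fderiv_eq, fderiv_const_apply]
  have hpair : fderiv ℝ (fun z => (ϑ z, s)) y h = (fderiv ℝ ϑ y h, 0) := by
    rw [hϑ.fderiv_prodMk (differentiableAt_const s), fderiv_const_apply]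
    rfl
  have hleib := fderiv_two_apply hP (hϑ.prodMk (differentiableAt_const s))
    (differentiableAt_const b) h
  have hz : jacobiBivector (Λ y) (E y) ![(ϑ y, s), 0] = 0 :=
    (jacobiBivector (Λ y) (E y)).map_coord_zero 1 rfl
  rw [hconst, hpair, two_swap _ (fderiv ℝ ϑ y h, 0) b, jacobiBivector_apply, zero_mul, add_zero,
    fderiv_const_apply, zero_apply, zero_apply, hz, add_zero] at hleib
  exact (sub_eq_zero.1 ((sub_eq_add_neg _ _).trans hleib.symm))

/- The pullback of `dϑ` by the anchor. Since `(Λ, E)^# (ϑ, s)` is the constant section `(0, r)`,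
differentiating `(Λ, E)((ϑ, s), b)` trades all derivatives of `(Λ, E)` for derivatives of `ϑ`. -/
theorem TwistedJacobiEqAt.extDeriv_oneForm (H : TwistedJacobiEqAt Λ E ω y)
    (hP : DifferentiableAt ℝ (fun y => jacobiBivector (Λ y) (E y)) y)
    {ϑ : V → V →L[ℝ] ℝ} (hϑ : DifferentiableAt ℝ ϑ y) {s r : ℝ}
    (hS : ∀ᶠ z in nhds y, jacobiSharp (Λ z) (E z) (ϑ z, s) = (0, r)) (b c : (V →L[ℝ] ℝ) × ℝ) :
    extDeriv (fun y => oneForm (ϑ y)) y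
        ![(jacobiSharp (Λ y) (E y) b).1, (jacobiSharp (Λ y) (E y) c).1] =
      r * (ω y ![(jacobiSharp (Λ y) (E y) b).1, (jacobiSharp (Λ y) (E y) c).1] -
        Λ y ![b.1, c.1]) := by
  have h := H.expand (ϑ y, s) b c
  have hdω (u v : V) : extDeriv ω y ![0, u, v] = 0 := (extDeriv ω y).map_coord_zero 0 rfl
  have hω (u : V) : ω y ![0, u] = 0 := (ω y).map_coord_zero 0 rfl
  have hΛ : jacobiBivector (Λ y) (E y) ![b, c] = Λ y ![b.1, c.1] +
      c.2 * (jacobiSharp (Λ y) (E y) b).2 - b.2 * (jacobiSharp (Λ y) (E y) c).2 := by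
    rw [jacobiBivector, pair_two_apply, oneForm_apply, oneForm_apply, jacobiSharp_snd,
      jacobiSharp_snd]
    change _ + b.2 * c.1 (E y) - c.2 * b.1 (E y) = _
    ring
  simp only [fderiv_jacobiBivector_of_eventually_jacobiSharp_eq hP hϑ hS, hΛ,
    jacobiBivector_apply (Λ y) (E y) (ϑ y, s), hS.self_of_nhds, map_zero,
    ContinuousAlternatingMap.coe_zero, Pi.zero_apply, hdω, hω] at h
  rw [extDeriv_oneForm_apply]
  linear_combination (-1 : ℝ) * h

section LocallyConformallySymplectic

variable {s : Set V}

theorem TwistedJacobiEqAt.extDeriv_lcsCovector (H : TwistedJacobiEqAt Λ E ω y) (hs : IsOpen s)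
    (hy : y ∈ s) (hP : ContDiffOn ℝ 1 (fun z => jacobiBivector (Λ z) (E z)) s)
    (hΛ : ∀ z ∈ s, (sharpL (Λ z)).IsInvertible) :
    extDeriv (fun z => oneForm (lcsCovector (Λ z) (E z))) y = 0 := by
  have hϑ := ((contDiffOn_lcsCovector hP hΛ).differentiableOn one_ne_zero).differentiableAt
    (hs.mem_nhds hy)
  have hS : ∀ᶠ z in nhds y, jacobiSharp (Λ z) (E z) (lcsCovector (Λ z) (E z), -1) = (0, 0) :=
    (hs.eventually_mem hy).mono fun z hz => jacobiSharp_lcsCovector (hΛ z hz)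
  refine ext_two fun u v => ?_
  have h := H.extDeriv_oneForm ((hP.differentiableOn one_ne_zero).differentiableAt
    (hs.mem_nhds hy)) hϑ hS ((sharpL (Λ y)).inverse u, 0) ((sharpL (Λ y)).inverse v, 0)
  rw [jacobiSharp_covector_fst, jacobiSharp_covector_fst, zero_mul] at h
  rw [← (hΛ y hy).self_apply_inverse u, ← (hΛ y hy).self_apply_inverse v]
  exact h

theorem fderiv_jacobiBivector_eq_neg_fderiv_lcsForm (hs : IsOpen s) (hy : y ∈ s)
    (hP : ContDiffOn ℝ 1 (fun z => jacobiBivector (Λ z) (E z)) s)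
    (hΛ : ∀ z ∈ s, (sharpL (Λ z)).IsInvertible) (β γ : V →L[ℝ] ℝ) (h : V) :
    fderiv ℝ (fun z => jacobiBivector (Λ z) (E z)) y h ![(β, 0), (γ, 0)] =
      -fderiv ℝ (fun z => lcsForm (Λ z)) y h ![sharp (Λ y) β, sharp (Λ y) γ] := by
  have hat {F : Type _} [NormedAddCommGroup F] [NormedSpace ℝ F] {f : V → F}
      (hf : ContDiffOn ℝ 1 f s) : DifferentiableAt ℝ f y :=
    (hf.differentiableOn one_ne_zero).differentiableAt (hs.mem_nhds hy)
  have hsharp : DifferentiableAt ℝ (fun z => sharp (Λ z) β) y :=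
    (hat (contDiffOn_sharpL hP)).clm_apply (differentiableAt_const β)
  -- Differentiate `Λ(β, γ) = ⟨γ, Λ^# β⟩` and, with `v = Λ^# γ` fixed, `Θ(Λ^# β, v) = -⟨β, v⟩`.
  have hP' : fderiv ℝ (fun z => jacobiBivector (Λ z) (E z)) y h ![(β, 0), (γ, 0)] =
      γ (fderiv ℝ (fun z => sharp (Λ z) β) y h) := by
    have happly : (fun z => jacobiBivector (Λ z) (E z) ![(β, 0), (γ, 0)]) =
        fun z => γ (sharp (Λ z) β) :=
      funext fun z => by rw [jacobiBivector_covector_apply, apply_sharp]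
    have hcomp := congrArg (· h) (γ.hasFDerivAt.comp y hsharp.hasFDerivAt).fderiv
    have hconst := congrArg (· h) (fderiv_continuousAlternatingMap_apply_const (hat hP)
      ![(β, 0), (γ, 0)])
    rw [happly] at hconst
    exact hconst.symm.trans hcomp
  have hΘ : fderiv ℝ (fun z => lcsForm (Λ z)) y h ![sharp (Λ y) β, sharp (Λ y) γ] +
      lcsForm (Λ y) ![fderiv ℝ (fun z => sharp (Λ z) β) y h, sharp (Λ y) γ] = 0 := by
    have hconst : (fun z => lcsForm (Λ z) ![sharp (Λ z) β, sharp (Λ y) γ]) =ᶠ[nhds y]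
        fun _ => -β (sharp (Λ y) γ) :=
      (hs.eventually_mem hy).mono fun z hz => lcsForm_apply_sharp_left (hΛ z hz) β _
    have hleib := fderiv_two_apply (hat (contDiffOn_lcsForm hP hΛ)) hsharp
      (differentiableAt_const (sharp (Λ y) γ)) h
    have hz (c : V) : lcsForm (Λ y) ![c, 0] = 0 := (lcsForm (Λ y)).map_coord_zero 1 rfl
    rw [hconst.fderiv_eq, fderiv_const_apply, fderiv_const_apply, zero_apply, zero_apply, hz,
      add_zero] at hleib
    exact hleib.symm
  rw [hP', eq_neg_of_add_eq_zero_left hΘ, neg_neg, two_swap, lcsForm_apply_sharp_left (hΛ y hy),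
    neg_neg]

theorem TwistedJacobiEqAt.extDeriv_lcsForm_sub (H : TwistedJacobiEqAt Λ E ω y) (hs : IsOpen s)
    (hy : y ∈ s) (hP : ContDiffOn ℝ 1 (fun z => jacobiBivector (Λ z) (E z)) s)
    (hΛ : ∀ z ∈ s, (sharpL (Λ z)).IsInvertible) (hω : DifferentiableAt ℝ ω y) :
    extDeriv (fun z => lcsForm (Λ z) - ω z) y + castDegree (Nat.add_comm 1 2)
      (wedge (oneForm (lcsCovector (Λ y) (E y))) (lcsForm (Λ y) - ω y)) = 0 := by
  have hΘ := ((contDiffOn_lcsForm hP hΛ).differentiableOn one_ne_zero).differentiableAt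
    (hs.mem_nhds hy)
  have hsurj (u : V) : ∃ α, u = sharp (Λ y) α := ⟨_, ((hΛ y hy).self_apply_inverse u).symm⟩
  refine ext_three fun u v w => ?_
  obtain ⟨α, rfl⟩ := hsurj u
  obtain ⟨β, rfl⟩ := hsurj v
  obtain ⟨γ, rfl⟩ := hsurj w
  have hS (α : V →L[ℝ] ℝ) : jacobiSharp (Λ y) (E y) (α, 0) =
      (sharp (Λ y) α, lcsCovector (Λ y) (E y) (sharp (Λ y) α)) := by
    refine Prod.ext (jacobiSharp_covector_fst ..) ?_
    rw [jacobiSharp_snd, apply_sharp_swap, sharp_lcsCovector (hΛ y hy)]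
  have hwedge : castDegree (Nat.add_comm 1 2)
      (wedge (oneForm (lcsCovector (Λ y) (E y))) (lcsForm (Λ y) - ω y))
      ![sharp (Λ y) α, sharp (Λ y) β, sharp (Λ y) γ] = _ := wedge_one_two ..
  have h := H.expand (α, 0) (β, 0) (γ, 0)
  simp only [hS, fderiv_jacobiBivector_eq_neg_fderiv_lcsForm hs hy hP hΛ,
    jacobiBivector_covector_apply, ← lcsForm_apply_sharp_sharp (hΛ y hy), extDeriv_two_apply] at h
  rw [ContinuousAlternatingMap.add_apply, hwedge, extDeriv_two_apply, fderiv_fun_sub hΘ hω]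
  simp only [ContinuousAlternatingMap.sub_apply, sub_apply, oneForm_apply, Matrix.cons_val_zero,
    ContinuousAlternatingMap.coe_zero, Pi.zero_apply]
  linear_combination -h

end LocallyConformallySymplectic

theorem TwistedJacobiEqAt.extDeriv_contactCovector (H : TwistedJacobiEqAt Λ E ω y) {s : Set V}
    (hs : IsOpen s) (hy : y ∈ s) (hP : ContDiffOn ℝ 1 (fun z => jacobiBivector (Λ z) (E z)) s)
    (hΛE : ∀ z ∈ s, (jacobiSharpL (Λ z) (E z)).IsInvertible) (b c : (V →L[ℝ] ℝ) × ℝ) :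
    (extDeriv (fun z => oneForm (contactCovector (Λ z) (E z))) y + ω y)
        ![(jacobiSharp (Λ y) (E y) b).1, (jacobiSharp (Λ y) (E y) c).1] = Λ y ![b.1, c.1] := by
  have hϑ := ((contDiffOn_contactCovector hP hΛE).differentiableOn one_ne_zero).differentiableAt
    (hs.mem_nhds hy)
  have hS : ∀ᶠ z in nhds y, jacobiSharp (Λ z) (E z) (contactCovector (Λ z) (E z), 0) = (0, -1) :=
    (hs.eventually_mem hy).mono fun z hz => jacobiSharp_contactCovector (hΛE z hz)
  rw [ContinuousAlternatingMap.add_apply, H.extDeriv_oneForm ((hP.differentiableOn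
    one_ne_zero).differentiableAt (hs.mem_nhds hy)) hϑ hS]
  ring

end Structure

end FlatCalculus

/-! ### Twisted Jacobi structures on manifolds -/

section ContactPoint

variable {U : Type*} [AddCommGroup U] [Module ℝ U] [TopologicalSpace U] [IsTopologicalAddGroup U]
  [ContinuousSMul ℝ U] [T2Space U] [FiniteDimensional ℝ U]
  {Λ : (U →L[ℝ] ℝ) [⋀^Fin 2]→L[ℝ] ℝ} {E : U} {Θ : U [⋀^Fin 2]→L[ℝ] ℝ}

theorem exists_jacobiSharp_fst_eq (hΛE : (jacobiSharpL Λ E).IsInvertible) (u : U) :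
    ∃ b, (jacobiSharp Λ E b).1 = u ∧ b.2 = contactCovector Λ E u := by
  refine ⟨(jacobiSharpL Λ E).inverse (u, 0), ?_⟩
  set b := (jacobiSharpL Λ E).inverse (u, 0)
  have hb : (jacobiSharp Λ E b).1 = u := congrArg Prod.fst (hΛE.self_apply_inverse (u, 0))
  refine ⟨hb, ?_⟩
  rw [← hb, jacobiSharp_fst, map_add, map_smul, apply_sharp_swap, sharp_contactCovector hΛE,
    map_zero, neg_zero, zero_add, contactCovector_apply hΛE, smul_eq_mul, mul_one]

variable (hΛE : (jacobiSharpL Λ E).IsInvertible)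
  (hΘ : ∀ b c, Θ ![(jacobiSharp Λ E b).1, (jacobiSharp Λ E c).1] = Λ ![b.1, c.1])

include hΛE hΘ

theorem apply_vector_eq_zero_of_anchor_pullback (v : U) : Θ ![E, v] = 0 := by
  obtain ⟨c, rfl, -⟩ := exists_jacobiSharp_fst_eq hΛE v
  have h := hΘ (0, 1) c
  rw [jacobiSharp_fst, map_zero, zero_add, one_smul] at h
  exact h.trans (Λ.map_coord_zero 0 rfl)

theorem apply_sharp_of_anchor_pullback (α : U →L[ℝ] ℝ) (v : U) :
    Θ ![sharp Λ α, v] = -(α v - α E * contactCovector Λ E v) := by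
  obtain ⟨c, rfl, hc⟩ := exists_jacobiSharp_fst_eq hΛE v
  have h := hΘ (α, 0) c
  rw [jacobiSharp_covector_fst] at h
  rw [h, ← hc, jacobiSharp_fst, map_add, map_smul, apply_sharp, two_swap, smul_eq_mul]
  ring

theorem eq_zero_of_anchor_pullback {u : U} (hϑ : contactCovector Λ E u = 0)
    (hu : ∀ v, Θ ![u, v] = 0) : u = 0 := by
  obtain ⟨b, rfl, hb⟩ := exists_jacobiSharp_fst_eq hΛE u
  refine ext_continuousDual fun β => ?_
  rw [jacobiSharp_fst, hb, hϑ, zero_smul, add_zero, apply_sharp, map_zero]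
  exact (hΘ b (β, 0)).symm.trans (hu _)

end ContactPoint

section Charts

variable {V : Type*} [NormedAddCommGroup V] [NormedSpace ℝ V]
  {M : Type*} [TopologicalSpace M] [ChartedSpace V M]

/-- The coordinate expression of a bivector field in the chart centred at `x₀`. -/
def BivectorField.inChart (Λ : BivectorField V M) (x₀ : M) (y : V) :
    (V →L[ℝ] ℝ) [⋀^Fin 2]→L[ℝ] ℝ :=
  (Λ ((extChartAt 𝓘(ℝ, V) x₀).symm y)).compContinuousLinearMap
    (.precomp ℝ (chartDeriv x₀ ((extChartAt 𝓘(ℝ, V) x₀).symm y)))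

/-- The coordinate expression of a vector field in the chart centred at `x₀`. -/
def VField.inChart (E : VField V M) (x₀ : M) (y : V) : V :=
  chartDeriv x₀ ((extChartAt 𝓘(ℝ, V) x₀).symm y) (E ((extChartAt 𝓘(ℝ, V) x₀).symm y))

theorem jacobiSection_inChart (Λ : BivectorField V M) (E : VField V M) (x₀ : M) :
    (jacobiSection Λ E).inChart x₀ = fun y => jacobiBivector (Λ.inChart x₀ y) (E.inChart x₀ y) :=
  funext fun _ => (jacobiBivector_map _ _ _).symm

theorem BivectorField.inChart_extChartAt_self (Λ : BivectorField V M) (x : M) :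
    Λ.inChart x (extChartAt 𝓘(ℝ, V) x x) =
      (Λ x).compContinuousLinearMap (.precomp ℝ (chartDeriv x x)) := by
  rw [BivectorField.inChart, extChartAt_to_inv x]

theorem VField.inChart_extChartAt_self (E : VField V M) (x : M) :
    E.inChart x (extChartAt 𝓘(ℝ, V) x x) = chartDeriv x x (E x) := by
  rw [VField.inChart, extChartAt_to_inv x]

section ChartDeriv

variable [IsManifold 𝓘(ℝ, V) 1 M] {x₀ x : M} {y : V}

theorem isInvertible_chartDeriv (hx : x ∈ (extChartAt 𝓘(ℝ, V) x₀).source) :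
    (chartDeriv (V := V) x₀ x).IsInvertible := by
  obtain ⟨e, he⟩ := isInvertible_mfderiv_extChartAt (I := 𝓘(ℝ, V)) hx
  refine ⟨e.trans (NormedSpace.fromTangentSpace (extChartAt 𝓘(ℝ, V) x₀ x)), ?_⟩
  rw [chartDeriv, ← he]
  rfl

theorem chartSymmDeriv_eq_inverse (hy : y ∈ (extChartAt 𝓘(ℝ, V) x₀).target) :
    chartSymmDeriv x₀ y = (chartDeriv x₀ ((extChartAt 𝓘(ℝ, V) x₀).symm y)).inverse := by
  have h := mfderiv_extChartAt_comp_mfderivWithin_extChartAt_symm (I := 𝓘(ℝ, V)) hy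
  rw [ModelWithCorners.range_eq_univ, mfderivWithin_univ] at h
  ext v
  rw [eq_comm, (isInvertible_chartDeriv ((extChartAt 𝓘(ℝ, V) x₀).map_target hy)).inverse_apply_eq]
  exact (congrArg (· v) h).symm

theorem Form.inChart_comp_chartDeriv {k : ℕ} (η : Form V M k) (x : M) :
    (η.inChart x (extChartAt 𝓘(ℝ, V) x x)).compContinuousLinearMap (chartDeriv x x) = η x := by
  have hinv := isInvertible_chartDeriv (V := V) (mem_extChartAt_source (I := 𝓘(ℝ, V)) x)
  have h (z : M) (hz : z = x) : ((η z).compContinuousLinearMap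
      (chartDeriv x z).inverse).compContinuousLinearMap (chartDeriv x x) = η x := by
    subst hz
    ext v
    exact congrArg (η z) (funext fun i => hinv.inverse_apply_self (v i))
  rw [Form.inChart, chartSymmDeriv_eq_inverse (mem_extChartAt_target x)]
  exact h _ (extChartAt_to_inv x)

end ChartDeriv

variable [FiniteDimensional ℝ V] {Λ : BivectorField V M} {E : VField V M} {ω : Form V M 2}

theorem IsTwistedJacobi.contDiffOn_inChart (hJ : IsTwistedJacobi Λ E ω) (x₀ : M) :
    ContDiffOn ℝ (⊤ : ℕ∞) (fun y => jacobiBivector (Λ.inChart x₀ y) (E.inChart x₀ y))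
      (extChartAt 𝓘(ℝ, V) x₀).target :=
  jacobiSection_inChart Λ E x₀ ▸ hJ.smooth_jacobiSection x₀

theorem IsTransitive.anchorSurjective (hT : IsTransitive Λ E) (x : M) :
    AnchorSurjective (Λ x) (E x) :=
  LinearMap.range_eq_top.1 (Submodule.eq_top_of_finrank_eq (hT x))

variable [IsManifold 𝓘(ℝ, V) 1 M]

theorem IsTwistedJacobi.twistedJacobiEqAt (hJ : IsTwistedJacobi Λ E ω) (x : M) :
    TwistedJacobiEqAt (Λ.inChart x) (E.inChart x) (ω.inChart x) (extChartAt 𝓘(ℝ, V) x x) := by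
  intro a
  have hinv := isInvertible_chartDeriv (V := V) (mem_extChartAt_source (I := 𝓘(ℝ, V)) x)
  have hdual (i : Fin 3) : dualProd (chartDeriv x x).inverse (dualProd (chartDeriv x x) (a i)) =
      a i := dualProd_dualProd hinv.self_comp_inverse (a i)
  have h := hJ.schouten_eq x fun i => dualProd (chartDeriv x x) (a i)
  rw [Form.d, ← ω.inChart_comp_chartDeriv x, pair_comp] at h
  rw [Λ.inChart_extChartAt_self, E.inChart_extChartAt_self, jacobiSharpExt_map]
  refine Eq.trans ?_ h
  rw [schouten01, jacobiSection_inChart, ContinuousAlternatingMap.compContinuousLinearMap_apply]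
  exact congrArg (1 / 2 * schoutenFlatMod _ _ _ _ ·) (funext hdual).symm

section LocallyConformallySymplectic

variable {x₀ : M} {y : V} (hΛ : ∀ x, (sharpL (Λ x)).IsInvertible)

include hΛ

theorem isInvertible_sharpL_inChart (hy : y ∈ (extChartAt 𝓘(ℝ, V) x₀).target) :
    (sharpL (Λ.inChart x₀ y)).IsInvertible :=
  isInvertible_sharpL_map (hΛ _)
    (isInvertible_chartDeriv ((extChartAt 𝓘(ℝ, V) x₀).map_target hy))

theorem lcsCovector_inChart (hy : y ∈ (extChartAt 𝓘(ℝ, V) x₀).target) :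
    Form.inChart (fun x => oneForm (lcsCovector (Λ x) (E x))) x₀ y =
      oneForm (lcsCovector (Λ.inChart x₀ y) (E.inChart x₀ y)) := by
  have hinv := isInvertible_chartDeriv ((extChartAt 𝓘(ℝ, V) x₀).map_target hy)
  rw [BivectorField.inChart, VField.inChart, lcsCovector_map (hΛ _) hinv, Form.inChart,
    chartSymmDeriv_eq_inverse hy]
  rfl

theorem lcsForm_inChart (hy : y ∈ (extChartAt 𝓘(ℝ, V) x₀).target) :
    Form.inChart (fun x => lcsForm (Λ x)) x₀ y = lcsForm (Λ.inChart x₀ y) := by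
  have hinv := isInvertible_chartDeriv ((extChartAt 𝓘(ℝ, V) x₀).map_target hy)
  rw [BivectorField.inChart, lcsForm_map (hΛ _) hinv, Form.inChart, chartSymmDeriv_eq_inverse hy]

theorem IsTwistedJacobi.d_lcsCovector (hJ : IsTwistedJacobi Λ E ω) (x : M) :
    Form.d (fun x => oneForm (lcsCovector (Λ x) (E x))) x = 0 := by
  have hmem := extChartAt_target_mem_nhds (I := 𝓘(ℝ, V)) x
  have hloc : Form.inChart (fun x => oneForm (lcsCovector (Λ x) (E x))) x =ᶠ[nhds _]
      fun y => oneForm (lcsCovector (Λ.inChart x y) (E.inChart x y)) :=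
    Filter.eventually_of_mem hmem fun y hy => lcsCovector_inChart hΛ hy
  rw [Form.d, hloc.extDeriv_eq, (hJ.twistedJacobiEqAt x).extDeriv_lcsCovector
    (isOpen_extChartAt_target x) (mem_extChartAt_target x)
    ((hJ.contDiffOn_inChart x).of_le (by simp)) fun y hy => isInvertible_sharpL_inChart hΛ hy]
  rfl

theorem IsTwistedJacobi.d_lcsForm_sub (hJ : IsTwistedJacobi Λ E ω) (x : M) :
    Form.d ((fun x => lcsForm (Λ x)) - ω) x + castDegree (Nat.add_comm 1 2)
      (wedge (oneForm (lcsCovector (Λ x) (E x))) (lcsForm (Λ x) - ω x)) = 0 := by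
  have hmem := extChartAt_target_mem_nhds (I := 𝓘(ℝ, V)) x
  have hloc : Form.inChart ((fun x => lcsForm (Λ x)) - ω) x =ᶠ[nhds _]
      fun y => lcsForm (Λ.inChart x y) - ω.inChart x y :=
    Filter.eventually_of_mem hmem fun y hy => congrArg (· - ω.inChart x y) (lcsForm_inChart hΛ hy)
  have hϑ := Form.inChart_comp_chartDeriv (fun x => oneForm (lcsCovector (Λ x) (E x))) x
  have hΘ := Form.inChart_comp_chartDeriv ((fun x => lcsForm (Λ x)) - ω) x
  have hω : DifferentiableAt ℝ (ω.inChart x) (extChartAt 𝓘(ℝ, V) x x) :=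
    ((hJ.smooth_form x).contDiffAt hmem).differentiableAt (by simp)
  have h := (hJ.twistedJacobiEqAt x).extDeriv_lcsForm_sub (isOpen_extChartAt_target x)
    (mem_extChartAt_target x) ((hJ.contDiffOn_inChart x).of_le (by simp))
    (fun y hy => isInvertible_sharpL_inChart hΛ hy) hω
  rw [lcsCovector_inChart hΛ (mem_extChartAt_target x)] at hϑ
  rw [hloc.self_of_nhds] at hΘ
  have hwedge : castDegree (Nat.add_comm 1 2)
      (wedge (oneForm (lcsCovector (Λ x) (E x))) (lcsForm (Λ x) - ω x)) = _ :=
    (congrArg₂ (fun a b => castDegree _ (wedge a b)) hϑ hΘ).symm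
  rw [Form.d, hloc.extDeriv_eq, hwedge, ← wedge_comp, ← castDegree_comp]
  exact ContinuousAlternatingMap.ext fun v => congrArg (· (chartDeriv x x ∘ v)) h

theorem IsTwistedJacobi.isTwistedLCS (hJ : IsTwistedJacobi Λ E ω)
    (heven : Even (Module.finrank ℝ V)) :
    IsTwistedLCS (fun x => lcsCovector (Λ x) (E x)) (fun x => lcsForm (Λ x)) ω where
  even_dim := heven
  smooth_covector x₀ := (contDiffOn_oneForm (contDiffOn_lcsCovector (hJ.contDiffOn_inChart x₀)
    fun _ hy => isInvertible_sharpL_inChart hΛ hy)).congr fun _ hy => lcsCovector_inChart hΛ hy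
  smooth_two_form x₀ := (contDiffOn_lcsForm (hJ.contDiffOn_inChart x₀)
    fun _ hy => isInvertible_sharpL_inChart hΛ hy).congr fun _ hy => lcsForm_inChart hΛ hy
  smooth_twist := hJ.smooth_form
  nondegenerate x _ hu := lcsForm_nondegenerate (hΛ x) hu
  closed := hJ.d_lcsCovector hΛ
  d_eq := hJ.d_lcsForm_sub hΛ

omit [IsManifold 𝓘(ℝ, V) 1 M] in
theorem isInducedByLCS (E : VField V M) :
    IsInducedByLCS Λ E (fun x => lcsCovector (Λ x) (E x)) (fun x => lcsForm (Λ x)) where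
  contract_E x v := by
    have h := lcsForm_apply_sharp_left (hΛ x) (lcsCovector (Λ x) (E x)) v
    rwa [sharp_lcsCovector (hΛ x)] at h
  contract_sharp x := lcsForm_apply_sharp_left (hΛ x)

end LocallyConformallySymplectic

section Contact

variable {x₀ : M} {y : V} (hΛE : ∀ x, (jacobiSharpL (Λ x) (E x)).IsInvertible)

include hΛE

theorem isInvertible_jacobiSharpL_inChart (hy : y ∈ (extChartAt 𝓘(ℝ, V) x₀).target) :
    (jacobiSharpL (Λ.inChart x₀ y) (E.inChart x₀ y)).IsInvertible :=
  isInvertible_jacobiSharpL_map (hΛE _)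
    (isInvertible_chartDeriv ((extChartAt 𝓘(ℝ, V) x₀).map_target hy))

theorem contactCovector_inChart (hy : y ∈ (extChartAt 𝓘(ℝ, V) x₀).target) :
    Form.inChart (fun x => oneForm (contactCovector (Λ x) (E x))) x₀ y =
      oneForm (contactCovector (Λ.inChart x₀ y) (E.inChart x₀ y)) := by
  have hinv := isInvertible_chartDeriv ((extChartAt 𝓘(ℝ, V) x₀).map_target hy)
  rw [BivectorField.inChart, VField.inChart, contactCovector_map (hΛE _) hinv, Form.inChart,
    chartSymmDeriv_eq_inverse hy]
  rfl

theorem IsTwistedJacobi.d_contactCovector (hJ : IsTwistedJacobi Λ E ω) (x : M)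
    (b c : (TangentSpace 𝓘(ℝ, V) x →L[ℝ] ℝ) × ℝ) :
    (Form.d (fun x => oneForm (contactCovector (Λ x) (E x))) x + ω x)
      ![(jacobiSharp (Λ x) (E x) b).1, (jacobiSharp (Λ x) (E x) c).1] = Λ x ![b.1, c.1] := by
  have hloc : Form.inChart (fun x => oneForm (contactCovector (Λ x) (E x))) x =ᶠ[nhds _]
      fun y => oneForm (contactCovector (Λ.inChart x y) (E.inChart x y)) :=
    Filter.eventually_of_mem (extChartAt_target_mem_nhds x) fun y hy =>
      contactCovector_inChart hΛE hy
  have hinv := isInvertible_chartDeriv (V := V) (mem_extChartAt_source (I := 𝓘(ℝ, V)) x)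
  have hdual := dualProd_dualProd hinv.inverse_comp_self
  have h := (hJ.twistedJacobiEqAt x).extDeriv_contactCovector
    (isOpen_extChartAt_target x) (mem_extChartAt_target x)
    ((hJ.contDiffOn_inChart x).of_le (by simp))
    (fun y hy => isInvertible_jacobiSharpL_inChart hΛE hy)
    (dualProd (chartDeriv x x).inverse b) (dualProd (chartDeriv x x).inverse c)
  rw [Λ.inChart_extChartAt_self, E.inChart_extChartAt_self, jacobiSharp_map, jacobiSharp_map,
    hdual, hdual] at h
  rw [Form.d, hloc.extDeriv_eq, ← ω.inChart_comp_chartDeriv x]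
  rw [ContinuousAlternatingMap.add_apply, comp_two, comp_two]
  refine Eq.trans h ((comp_two _ _ _ _).trans ?_)
  exact congrArg₂ (fun b c => Λ x ![b.1, c.1]) (hdual b) (hdual c)

theorem IsTwistedJacobi.isTwistedContact (hJ : IsTwistedJacobi Λ E ω) {n : ℕ}
    (hn : Module.finrank ℝ V = 2 * n + 1) :
    IsTwistedContact n (fun x => contactCovector (Λ x) (E x)) ω where
  dim_eq := hn
  smooth_covector x₀ := (contDiffOn_oneForm (contDiffOn_contactCovector (hJ.contDiffOn_inChart x₀)
    fun _ hy => isInvertible_jacobiSharpL_inChart hΛE hy)).congr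
      fun _ hy => contactCovector_inChart hΛE hy
  smooth_twist := hJ.smooth_form
  wedge_ne_zero x := wedge_oneForm_wedgePow_ne_zero hn (contactCovector_apply (hΛE x))
    (apply_vector_eq_zero_of_anchor_pullback (hΛE x) (hJ.d_contactCovector hΛE x))
    fun _ => eq_zero_of_anchor_pullback (hΛE x) (hJ.d_contactCovector hΛE x)

theorem IsTwistedJacobi.isInducedByContact (hJ : IsTwistedJacobi Λ E ω) :
    IsInducedByContact Λ E (fun x => contactCovector (Λ x) (E x)) ω where
  apply_E x := contactCovector_apply (hΛE x)
  contract_E x := apply_vector_eq_zero_of_anchor_pullback (hΛE x) (hJ.d_contactCovector hΛE x)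
  sharp_eq_zero x := sharp_contactCovector (hΛE x)
  contract_sharp x := apply_sharp_of_anchor_pullback (hΛE x) (hJ.d_contactCovector hΛE x)

end Contact

end Charts

end TwistedJacobi

end

open TwistedJacobi in
theorem proposition3p1_general {V : Type*} [NormedAddCommGroup V] [NormedSpace ℝ V]
    [FiniteDimensional ℝ V] {M : Type*} [TopologicalSpace M] [ChartedSpace V M]
    [IsManifold 𝓘(ℝ, V) 1 M]
    (Λ : BivectorField V M) (E : VField V M) (ω : Form V M 2)
    (hJ : IsTwistedJacobi Λ E ω) (hT : IsTransitive Λ E) :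
    (Even (Module.finrank ℝ V) →
      ∃ (ϑ : CovectorField V M) (Θ : Form V M 2),
        IsTwistedLCS ϑ Θ ω ∧ IsInducedByLCS Λ E ϑ Θ ∧ ∀ x, E x = sharp (Λ x) (ϑ x)) ∧
    (∀ n : ℕ, Module.finrank ℝ V = 2 * n + 1 →
      ∃ ϑ : CovectorField V M, IsTwistedContact n ϑ ω ∧ IsInducedByContact Λ E ϑ ω) := by
  refine ⟨fun heven => ?_, fun n hn => ?_⟩
  · have hΛ x := (hT.anchorSurjective x).isInvertible_sharpL heven
    exact ⟨_, _, hJ.isTwistedLCS hΛ heven, isInducedByLCS hΛ E,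
      fun x => (sharp_lcsCovector (hΛ x)).symm⟩
  · have hΛE x := (hT.anchorSurjective x).isInvertible_jacobiSharpL ⟨n, hn⟩
    exact ⟨_, hJ.isTwistedContact hΛE hn, hJ.isInducedByContact hΛE⟩

open TwistedJacobi in
theorem proposition3p1 {V : Type*} [NormedAddCommGroup V] [NormedSpace ℝ V]
    [FiniteDimensional ℝ V] {M : Type*} [TopologicalSpace M] [ChartedSpace V M]
    [IsManifold 𝓘(ℝ, V) (⊤ : ℕ∞) M]
    (Λ : BivectorField V M) (E : VField V M) (ω : Form V M 2)
    (hJ : IsTwistedJacobi Λ E ω) (hT : IsTransitive Λ E) :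
    (Even (Module.finrank ℝ V) →
      ∃ (ϑ : CovectorField V M) (Θ : Form V M 2),
        IsTwistedLCS ϑ Θ ω ∧ IsInducedByLCS Λ E ϑ Θ ∧ ∀ x, E x = sharp (Λ x) (ϑ x)) ∧
    (∀ n : ℕ, Module.finrank ℝ V = 2 * n + 1 →
      ∃ ϑ : CovectorField V M, IsTwistedContact n ϑ ω ∧ IsInducedByContact Λ E ϑ ω) := by
  have : IsManifold 𝓘(ℝ, V) 1 M := .of_le (n := (⊤ : ℕ∞)) (by simp)
  exact proposition3p1_general Λ E ω hJ hT
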